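/- Let $g:[0,\infty)\to(0,\infty)$ be a $C^\infty$ map that is increasing and concave, with $g(0)=1$, $\lim_{x\to\infty}g(x)=\infty$ and $\int_2^\infty\frac{dx}{x\,G(\log x)}=\infty$, where $G(x)=\int_0^x g$. Put $\tau(s)=s/g(-\log s)$. Let $H_1:[-1,1]\to\mathbb R$ be an even $C^2$ map with $H_1(0)=H_1'(0)=0$ and $xH_1'(x)>0$ for $x\ne0$, such that the inverse $H_1^{-1}$ of $H_1|_{[0,1]}$ satisfies $(H_1^{-1})'(u)=g(-\log u)/\sqrt u$ for $0<u\le H_1(1)$. Let $m\ge1$, let $\widetilde H(x+iy)=-H_1(x)+y^2$, and let $H(z)=\widetilde H(z^m)$, with Hamiltonian equation $z'=-2i\,\partial H/\partial\bar z$. Fix $0<x_0\le1$ and put $s_0=H_1(x_0)$, $y_0=\sqrt{s_0}$. Let $\zeta=e^{\pi i/m}$, let $G_0$ be the principal branch of the $m$-th root and $G_j=\zeta^jG_0$. In the rectangle $[-x_0,x_0]\times[-y_0,y_0]$ let $R_1=\{x>0,\ H_1(x)>y^2\}$ and $R_2=\{y>0,\ H_1(x)<y^2\}$, and define the $4m$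 sectors $Q_{2j+1}=G_j(R_1)$ and $Q_{2j+2}=G_j(R_2)$ for $0\le j<2m$. For $0<s<s_0$, the orbit in $Q_{2j+1}$ on the level $H=-s$ enters at $G_j(x_0-i\sqrt{s_0-s})$ and leaves at $G_j(x_0+i\sqrt{s_0-s})$; the orbit in $Q_{2j+2}$ on the level $H=s$ enters at $G_j(-H_1^{-1}(s_0-s)+iy_0)$ and leaves at $G_j(H_1^{-1}(s_0-s)+iy_0)$. For $f:\mathbb C\to\mathbb C$ let $\varphi^i_f(s)$ be the integral of $f$ with respect to time along this orbit segment in $Q_i$, from its entrance to its exit. Let $f(z,\bar z)=\sum_{0\le k\le 2m-2}a_k z^k\bar z^{\,2m-2-k}$ with $a_k\in\mathbb C$. Then for every $1\le i\le4m$ the passage integral $\varphi^i_f$ is well defined and differentiable on $(0,s_0)$, and, as $s\to0^+$, $$(\varphi^i_f)'(s)=O(\tau(s)^{-1}),\qquad \tau(s)\,(\varphi^i_f)'(s)\to -C^i(f),$$ where, for $0\le j<2m$, $$C^{2j+1}(f)=\frac1{m^2}\sum_{0\le k\le 2m-2}a_k\,\zeta^{2j(k-(m-1))},\qquad C^{2j+2}(f)=\frac1{m^2}\sum_{0\le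 k\le 2m-2}a_k\,\zeta^{(2j+1)(k-(m-1))}\,\mathrm{Re}\,\zeta^{k-(m-1)}.$$ -/

import Mathlib

open Set Filter Topology MeasureTheory Asymptotics

noncomputable section

namespace ImperfectSaddle

/-- Admissible `g : [0,∞) → (0,∞)`: smooth, increasing, concave, unbounded, `g 0 = 1`, and
`∫_2^∞ dx / (x G(log x)) = ∞`, where `G` is the primitive of `g` with `G 0 = 0`.
Only the values of `g` on `[0,∞)` matter. -/
structure IsAdmissible (g : ℝ → ℝ) : Prop where
  smooth : ContDiffOn ℝ (⊤ : ℕ∞) g (Ici 0)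
  pos : ∀ x ∈ Ici (0 : ℝ), 0 < g x
  mono : MonotoneOn g (Ici 0)
  concave : ConcaveOn ℝ (Ici 0) g
  unbounded : Tendsto g atTop atTop
  divergence : ∫⁻ x in Ioi (2 : ℝ),
    ENNReal.ofReal (1 / (x * ∫ t in (0 : ℝ)..Real.log x, g t)) = ⊤
  zero : g 0 = 1

/-- The function `τ(s) = s / g(-log s)`. -/
def tau (g : ℝ → ℝ) (s : ℝ) : ℝ := s / g (-Real.log s)

/-- The inverse of the restriction of `H₁` to `[0,1]`. -/
def inverseBranch (H₁ : ℝ → ℝ) : ℝ → ℝ := Function.invFunOn H₁ (Icc 0 1)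

/-- `H₁ : [-1,1] → ℝ` is an even unimodal `C²` map with minimum value `0` at `0`, whose inverse
branch satisfies `(H₁⁻¹)'(u) = g(-log u) / √u` for `u ∈ (0, H₁ 1]`. Only the values of `H₁` on
`[-1,1]` matter; derivatives at `±1` and at `u = H₁ 1` are one-sided. -/
structure IsProfile (g H₁ : ℝ → ℝ) : Prop where
  contDiffOn : ContDiffOn ℝ 2 H₁ (Icc (-1) 1)
  even : ∀ x ∈ Icc (-1 : ℝ) 1, H₁ (-x) = H₁ x
  zero : H₁ 0 = 0
  deriv_zero : derivWithin H₁ (Icc (-1) 1) 0 = 0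
  unimodal : ∀ x ∈ Icc (-1 : ℝ) 1, x ≠ 0 → 0 < x * derivWithin H₁ (Icc (-1) 1) x
  inverse_deriv : ∀ u ∈ Ioc 0 (H₁ 1),
    HasDerivWithinAt (inverseBranch H₁) (g (-Real.log u) / √u) (Icc 0 (H₁ 1)) u

/-- The Hamiltonian `H̃(x,y) = -H₁(x) + y²`, at `ω = x + iy`. -/
def simpleHamiltonian (H₁ : ℝ → ℝ) (ω : ℂ) : ℝ := -H₁ ω.re + ω.im ^ 2

/-- The Hamiltonian of the multi-saddle, the pull-back of `H̃` by `z ↦ z^m`. -/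
def hamiltonian (H₁ : ℝ → ℝ) (m : ℕ) (z : ℂ) : ℝ := simpleHamiltonian H₁ (z ^ m)

/-- The Wirtinger derivative `∂H/∂z̄ = (∂H/∂x + i ∂H/∂y) / 2`. -/
def dbar (H : ℂ → ℝ) (z : ℂ) : ℂ :=
  ((fderiv ℝ H z 1 : ℝ) + Complex.I * (fderiv ℝ H z Complex.I : ℝ)) / 2

/-- The Hamiltonian vector field `-2i ∂H/∂z̄`. -/
def hamiltonianField (H : ℂ → ℝ) (z : ℂ) : ℂ := -2 * Complex.I * dbar H z

/-- The primitive `2m`-th root of unity `ζ = exp(πi/m)`. -/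
def zeta (m : ℕ) : ℂ := Complex.exp (Real.pi * Complex.I / m)

/-- The branch `G_j = ζ^j G_0` of the `m`-th root, `G_0` being the principal one. It is only used
away from the negative real axis, so the convention there is immaterial. -/
def rootBranch (m j : ℕ) (ω : ℂ) : ℂ := zeta m ^ j * ω ^ ((1 : ℂ) / m)

/-- The right sector `{H₁(x) > y²}`, `x > 0`, of the rectangle `[-x₀,x₀] × [-y₀,y₀]`, where
`H₁(x₀) = y₀²`. -/
def rightSector (H₁ : ℝ → ℝ) (x₀ : ℝ) : Set ℂ :=
  {ω | 0 < ω.re ∧ ω.re ≤ x₀ ∧ |ω.im| ≤ √(H₁ x₀) ∧ ω.im ^ 2 < H₁ ω.re}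

/-- The upper sector `{H₁(x) < y²}`, `y > 0`, of the same rectangle. -/
def upperSector (H₁ : ℝ → ℝ) (x₀ : ℝ) : Set ℂ :=
  {ω | |ω.re| ≤ x₀ ∧ 0 < ω.im ∧ ω.im ≤ √(H₁ x₀) ∧ H₁ ω.re < ω.im ^ 2}

/-- The sectors `Q_{2j+1} = G_j(right sector)` and `Q_{2j+2} = G_j(upper sector)`, `0 ≤ j < 2m`.
The index `i` runs from `1` to `4m`, and `j = (i - 1) / 2` (integer division). -/
def sector (H₁ : ℝ → ℝ) (m : ℕ) (x₀ : ℝ) (i : ℕ) : Set ℂ :=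
  rootBranch m ((i - 1) / 2) '' (if Odd i then rightSector H₁ x₀ else upperSector H₁ x₀)

/-- The entrance point of `Q_i` at parameter `s ∈ (0, H₁ x₀)`. It lies on the level `-s` of the
Hamiltonian for odd `i` and on the level `s` for even `i`. -/
def entrance (H₁ : ℝ → ℝ) (m : ℕ) (x₀ : ℝ) (i : ℕ) (s : ℝ) : ℂ :=
  rootBranch m ((i - 1) / 2)
    (if Odd i then ⟨x₀, -√(H₁ x₀ - s)⟩ else ⟨-inverseBranch H₁ (H₁ x₀ - s), √(H₁ x₀)⟩)

/-- The exit point of `Q_i` at parameter `s`. -/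
def exitPt (H₁ : ℝ → ℝ) (m : ℕ) (x₀ : ℝ) (i : ℕ) (s : ℝ) : ℂ :=
  rootBranch m ((i - 1) / 2)
    (if Odd i then ⟨x₀, √(H₁ x₀ - s)⟩ else ⟨inverseBranch H₁ (H₁ x₀ - s), √(H₁ x₀)⟩)

/-- `z : [0,r] → ℂ` is the orbit segment of the Hamiltonian flow that crosses the sector `Q_i`
from its entrance point to its exit point at parameter `s`. Between these two points it stays off
the boundary of the preimage of the rectangle `[-x₀,x₀] × [-y₀,y₀]`. -/
structure IsPassage (H₁ : ℝ → ℝ) (m : ℕ) (x₀ : ℝ) (i : ℕ) (s r : ℝ) (z : ℝ → ℂ) : Prop where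
  pos : 0 < r
  start : z 0 = entrance H₁ m x₀ i s
  finish : z r = exitPt H₁ m x₀ i s
  continuousOn : ContinuousOn z (Icc 0 r)
  mem_sector : ∀ t ∈ Icc 0 r, z t ∈ sector H₁ m x₀ i
  inside : ∀ t ∈ Ioo 0 r, |(z t ^ m).re| < x₀ ∧ |(z t ^ m).im| < √(H₁ x₀)
  flow : ∀ t ∈ Ioo 0 r, HasDerivAt z (hamiltonianField (hamiltonian H₁ m) (z t)) t

open Classical in
/-- The passage integral `φ^i_f(s) = ∫_0^{r(s)} f(Ψ_t(entrance point)) dt`. -/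
def passageIntegral (H₁ : ℝ → ℝ) (m : ℕ) (x₀ : ℝ) (i : ℕ) (f : ℂ → ℂ) (s : ℝ) : ℂ :=
  if h : ∃ p : ℝ × (ℝ → ℂ), IsPassage H₁ m x₀ i s p.1 p.2 then
    ∫ t in (0 : ℝ)..h.choose.1, f (h.choose.2 t)
  else 0

/-- The homogeneous polynomial `∑_{0 ≤ k ≤ 2m-2} a_k z^k z̄^{2m-2-k}`. -/
def homPoly (m : ℕ) (a : ℕ → ℂ) (z : ℂ) : ℂ :=
  ∑ k ∈ Finset.range (2 * m - 1), a k * z ^ k * (starRingEnd ℂ z) ^ (2 * m - 2 - k)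

/-- The constant `C^{2j+1}(f)` of the image of the right sector under `G_j`. -/
def rightConstant (m : ℕ) (a : ℕ → ℂ) (j : ℕ) : ℂ :=
  1 / (m : ℂ) ^ 2 * ∑ k ∈ Finset.range (2 * m - 1),
    a k * zeta m ^ (2 * (j : ℤ) * ((k : ℤ) - ((m : ℤ) - 1)))

/-- The constant `C^{2j+2}(f)` of the image of the upper sector under `G_j`. -/
def upperConstant (m : ℕ) (a : ℕ → ℂ) (j : ℕ) : ℂ :=
  1 / (m : ℂ) ^ 2 * ∑ k ∈ Finset.range (2 * m - 1),
    a k * zeta m ^ ((2 * (j : ℤ) + 1) * ((k : ℤ) - ((m : ℤ) - 1)))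
      * ((zeta m ^ ((k : ℤ) - ((m : ℤ) - 1))).re : ℂ)

/-- The constants `C^{2j+1}(f)` and `C^{2j+2}(f)`, indexed by `1 ≤ i ≤ 4m`. -/
def sectorConstant (m : ℕ) (a : ℕ → ℂ) (i : ℕ) : ℂ :=
  if Odd i then rightConstant m a ((i - 1) / 2) else upperConstant m a ((i - 1) / 2)

end ImperfectSaddle

end

/-! The map ω = (-1)^j z^m carries the orbits in the image of G_j to orbits of the simple saddle
-H₁(x) + y², run at |m z^(m-1)|² = m²|z|^(2m-2) times the speed. The polynomial f is homogeneous of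
the same degree 2m-2, so f divided by this speed depends only on arg ω. It is a trigonometric
polynomial E(arg ω), the function `angular`. A passage integral is therefore the integral of E(arg
ω) with respect to the time of the simple saddle (`homPoly_rootBranch`,
`IsBaseOrbit.integral_homPoly`).

Let X = H₁⁻¹. On the right level curve x = X(s + y²) the time element is dy/H₁'(x) = g(-log u)/√u dy
with u = s + y². On the upper curve it is dx/(2√(s + H₁(x))), and x = X(v²) turns it into g(-log
v²)/√(s + v²) dv. Folding the two halves of the orbit together gives an integral over 0 < v < √(s₀ -
s) of an explicit density times P(arctan(y/x)), where P(θ) is E(θ) + E(-θ) on the right and E(θ) +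
E(π - θ) above (`IsProfile.integral_passage_right`, `IsProfile.integral_passage_upper`).

The integral is differentiated in s. The moving endpoint contributes a bounded term, which the
factor τ(s) → 0 removes. In the remaining integral put v = √s w. Concavity makes g slowly varying,
g(-log s + c)/g(-log s) → 1, so τ(s) times the derivative of the density tends to -(1/2)(1 +
w²)^(-3/2). The width bound X(u) ≥ 2√u g(-log u) forces the angle θ to 0 and makes the term with P'
negligible. Dominated convergence and ∫(1 + w²)^(-3/2) dw = 1 over (0,∞) give the limit -P(0)/2.
This is -E(0) on the right and -(E(0) + E(π))/2 above, which are the stated constants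
(`tendsto_integral_right`, `tendsto_integral_upper`, `angular_zero`, `angular_zero_add_angular_pi`).
-/

namespace ImperfectSaddle

/-! ### Leibniz rule with a moving endpoint, and the rescaled limit -/

/-- Leibniz rule for an integral whose integrand and upper endpoint both depend on the
parameter. -/
theorem hasDerivAt_integral_of_moving_endpoint {E : Type*} [NormedAddCommGroup E]
    [NormedSpace ℝ E] [CompleteSpace E] {Q : ℝ → ℝ → E} {Y : ℝ → ℝ} {s Y' : ℝ} {D : E}
    (hY : HasDerivAt Y Y' s)
    (hQ : ContinuousAt (Function.uncurry Q) (s, Y s))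
    (hD : HasDerivAt (fun σ => ∫ v in (0 : ℝ)..Y s, Q σ v) D s)
    (hint : ∀ᶠ σ in 𝓝 s, IntervalIntegrable (Q σ) volume 0 (Y s))
    (hint' : ∀ᶠ σ in 𝓝 s, IntervalIntegrable (Q σ) volume (Y s) (Y σ)) :
    HasDerivAt (fun σ => ∫ v in (0 : ℝ)..Y σ, Q σ v) (D + Y' • Q s (Y s)) s := by
  -- The strip between `Y s` and `Y σ` contributes `(Y σ - Y s) • Q s (Y s)` plus this remainder.
  -- Joint continuity makes the remainder o(Y σ - Y s), hence o(σ - s).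
  have hR : HasDerivAt (fun σ => ∫ v in (Y s)..Y σ, (Q σ v - Q s (Y s))) 0 s := by
    rw [hasDerivAt_iff_isLittleO]
    simp only [intervalIntegral.integral_same, sub_zero, smul_zero]
    refine IsLittleO.trans_isBigO ?_ hY.isBigO_sub
    rw [isLittleO_iff]
    intro ε hε
    obtain ⟨δ, hδ, hball⟩ := Metric.continuousAt_iff.1 hQ ε hε
    have h1 : ∀ᶠ σ in 𝓝 s, dist σ s < δ := Metric.ball_mem_nhds s hδ
    have h2 : ∀ᶠ σ in 𝓝 s, dist (Y σ) (Y s) < δ :=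
      hY.continuousAt.eventually (Metric.ball_mem_nhds (Y s) hδ)
    filter_upwards [h1, h2] with σ hσ hσ'
    rw [Real.norm_eq_abs]
    refine intervalIntegral.norm_integral_le_of_norm_le_const fun v hv => ?_
    rw [← dist_eq_norm]
    refine (hball (x := (σ, v)) ?_).le
    rw [Prod.dist_eq]
    refine max_lt hσ (lt_of_le_of_lt ?_ hσ')
    rw [Real.dist_eq, Real.dist_eq]
    exact abs_sub_left_of_mem_uIcc (uIoc_subset_uIcc hv)
  have hL : HasDerivAt (fun σ => (Y σ - Y s) • Q s (Y s)) (Y' • Q s (Y s)) s := by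
    simpa using (hY.sub_const (Y s)).smul_const (Q s (Y s))
  have := (hD.add hL).add hR
  rw [add_zero] at this
  refine this.congr_of_eventuallyEq ?_
  filter_upwards [hint, hint'] with σ h1 h2
  simp only [Pi.add_apply]
  rw [intervalIntegral.integral_sub h2 intervalIntegrable_const, intervalIntegral.integral_const,
    add_assoc, add_sub_cancel, intervalIntegral.integral_add_adjacent_intervals h1 h2]

theorem hasDerivAt_div_sqrt_one_add_sq (w : ℝ) :
    HasDerivAt (fun w : ℝ => w / √(1 + w ^ 2)) ((1 + w ^ 2) * √(1 + w ^ 2))⁻¹ w := by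
  have h0 : 0 < 1 + w ^ 2 := by positivity
  have h1 : HasDerivAt (fun w : ℝ => 1 + w ^ 2) (2 * w) w := by
    simpa using (hasDerivAt_pow 2 w).const_add 1
  have h2 := (hasDerivAt_id w).div (h1.sqrt h0.ne') (Real.sqrt_pos.2 h0).ne'
  refine h2.congr_deriv ?_
  have h3 : √(1 + w ^ 2) ^ 2 = 1 + w ^ 2 := Real.sq_sqrt h0.le
  have h4 := (Real.sqrt_pos.2 h0).ne'
  simp only [id]
  field_simp
  rw [h3]; ring

theorem tendsto_div_sqrt_one_add_sq :
    Tendsto (fun w : ℝ => w / √(1 + w ^ 2)) atTop (𝓝 1) := by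
  have h : Tendsto (fun w : ℝ => √(1 - (1 + w ^ 2)⁻¹)) atTop (𝓝 √(1 - 0)) := by
    refine (Tendsto.sub tendsto_const_nhds (Tendsto.inv_tendsto_atTop ?_)).sqrt
    exact tendsto_atTop_add_const_left _ _ (tendsto_pow_atTop two_ne_zero)
  rw [sub_zero, Real.sqrt_one] at h
  refine h.congr' ?_
  filter_upwards [eventually_ge_atTop 0] with w hw
  have h0 : 0 < 1 + w ^ 2 := by positivity
  rw [show 1 - (1 + w ^ 2)⁻¹ = w ^ 2 / (1 + w ^ 2) by field_simp; ring,
    Real.sqrt_div (sq_nonneg w), Real.sqrt_sq hw]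

/-- The primitive w/√(1 + w²) rises from 0 to 1. This total mass 1 leaves the pointwise limit as the
final constant. -/
theorem integral_Ioi_inv_one_add_sq_mul_sqrt :
    ∫ w in Ioi (0 : ℝ), ((1 + w ^ 2) * √(1 + w ^ 2))⁻¹ = 1 := by
  rw [integral_Ioi_of_hasDerivAt_of_nonneg' (fun w _ => hasDerivAt_div_sqrt_one_add_sq w)
    (fun w _ => by positivity) tendsto_div_sqrt_one_add_sq]
  simp

/-- Asymptotics of an integral over `[0, √(s₀ - s)]` whose integrand, rescaled by `v = √s w`,
converges to a multiple of `(1 + w²)^(-3/2)`. -/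
theorem tendsto_integral_of_rescaled {c : ℝ → ℝ} {D : ℝ → ℝ → ℂ} {s₀ : ℝ} {bnd : ℝ → ℝ} {l : ℂ}
    (hs₀ : 0 < s₀)
    (hmeas : ∀ᶠ s in 𝓝[>] (0 : ℝ),
      AEStronglyMeasurable (D s) (volume.restrict (Ioc 0 √(s₀ - s))))
    (hlim : ∀ w > 0, Tendsto (fun s => (c s * √s) • D s (√s * w)) (𝓝[>] 0)
      (𝓝 (((1 + w ^ 2) * √(1 + w ^ 2))⁻¹ • l)))
    (hbnd : ∀ᶠ s in 𝓝[>] (0 : ℝ), ∀ w > 0, √s * w ≤ √(s₀ - s) →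
      ‖(c s * √s) • D s (√s * w)‖ ≤ bnd w)
    (hnonneg : ∀ w, 0 ≤ bnd w)
    (hint : IntegrableOn bnd (Ioi 0)) :
    Tendsto (fun s => c s • ∫ v in (0 : ℝ)..√(s₀ - s), D s v) (𝓝[>] 0) (𝓝 l) := by
  -- Cutting off with an indicator replaces the s-dependent interval by the fixed half-line, where
  -- dominated convergence applies.
  have key : Tendsto (fun s => ∫ w in Ioi (0 : ℝ),
      (c s * √s) • (Ioc 0 √(s₀ - s)).indicator (D s) (√s * w)) (𝓝[>] 0)
      (𝓝 (∫ w in Ioi (0 : ℝ), ((1 + w ^ 2) * √(1 + w ^ 2))⁻¹ • l)) := by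
    refine tendsto_integral_filter_of_dominated_convergence bnd ?_ ?_ hint ?_
    · filter_upwards [hmeas, self_mem_nhdsWithin] with s hs hs0
      have h1 : AEStronglyMeasurable ((Ioc 0 √(s₀ - s)).indicator (D s)) volume :=
        (aestronglyMeasurable_indicator_iff measurableSet_Ioc).2 hs
      have hq : Measure.QuasiMeasurePreserving (fun w : ℝ => √s * w) volume volume := by
        refine ⟨measurable_const_mul _, ?_⟩
        rw [Real.map_volume_mul_left (Real.sqrt_pos.2 hs0).ne']
        exact Measure.smul_absolutelyContinuous
      have h2 : AEStronglyMeasurable (fun w => (Ioc 0 √(s₀ - s)).indicator (D s) (√s * w)) volume :=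
        h1.comp_quasiMeasurePreserving hq
      exact (h2.const_smul (c s * √s)).restrict
    · filter_upwards [hbnd] with s hs
      filter_upwards [ae_restrict_mem measurableSet_Ioi] with w hw
      by_cases h : √s * w ∈ Ioc 0 √(s₀ - s)
      · rw [indicator_of_mem h]
        exact hs w hw h.2
      · rw [indicator_of_notMem h, smul_zero, norm_zero]
        exact hnonneg w
    · filter_upwards [ae_restrict_mem measurableSet_Ioi] with w hw
      refine (hlim w hw).congr' ?_
      -- For fixed w the point √s w lies below √(s₀ - s) once s is small, so the cutoff disappears
      -- in the limit.
      have h1 : Tendsto (fun s : ℝ => √s * w - √(s₀ - s)) (𝓝[>] 0) (𝓝 (√0 * w - √(s₀ - 0))) := by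
        refine Tendsto.mono_left ?_ nhdsWithin_le_nhds
        exact Continuous.tendsto (by fun_prop) 0
      have h2 : √0 * w - √(s₀ - 0) < 0 := by simpa using hs₀
      filter_upwards [h1.eventually (gt_mem_nhds h2), self_mem_nhdsWithin] with s hs hs0
      rw [indicator_of_mem]
      exact ⟨mul_pos (Real.sqrt_pos.2 hs0) hw, by linarith⟩
  have hval : ∫ w in Ioi (0 : ℝ), ((1 + w ^ 2) * √(1 + w ^ 2))⁻¹ • l = l := by
    rw [integral_smul_const, integral_Ioi_inv_one_add_sq_mul_sqrt, one_smul]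
  rw [hval] at key
  refine key.congr' ?_
  filter_upwards [self_mem_nhdsWithin] with s hs0
  have hs : 0 < √s := Real.sqrt_pos.2 hs0
  rw [integral_smul, integral_comp_mul_left_Ioi _ _ hs, mul_zero, smul_smul, mul_assoc,
    mul_inv_cancel₀ hs.ne', mul_one, intervalIntegral.integral_of_le (Real.sqrt_nonneg _),
    setIntegral_indicator measurableSet_Ioc]
  congr 3
  exact inter_eq_right.2 Ioc_subset_Ioi_self

end ImperfectSaddle

/-! ### Slow growth, the time density and angular functions -/

namespace ImperfectSaddle

/-- The growth properties of an admissible `g`, extended by a constant to the negative axis. -/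
structure SlowGrowth (g : ℝ → ℝ) (M : ℝ) : Prop where
  cont : Continuous g
  mono : Monotone g
  one_le : ∀ x, 1 ≤ g x
  diff : ∀ x > 0, DifferentiableAt ℝ g x
  deriv_le : ∀ x ≥ 1, |deriv g x| ≤ M
  add_le : ∀ x ≥ 0, ∀ c ≥ 0, g (x + c) ≤ g x + g c
  linear : ∀ c ≥ 0, g c ≤ M * (1 + c)
  top : Tendsto g atTop atTop

/-- `X` is a primitive of `g(-log u) / √u` on `(0,∞)` with the lower bound it has when it vanishes
at `0`. -/
structure IsWidth (g X : ℝ → ℝ) : Prop where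
  hasDerivAt : ∀ u > 0, HasDerivAt X (g (-Real.log u) / √u) u
  le : ∀ u > 0, 2 * √u * g (-Real.log u) ≤ X u

variable {g X : ℝ → ℝ} {M : ℝ}

theorem SlowGrowth.pos (hg : SlowGrowth g M) (x : ℝ) : 0 < g x := one_pos.trans_le (hg.one_le x)

theorem SlowGrowth.nonneg_const (hg : SlowGrowth g M) : 0 ≤ M :=
  (abs_nonneg _).trans (hg.deriv_le 1 le_rfl)

theorem IsWidth.pos (hg : SlowGrowth g M) (hX : IsWidth g X) {u : ℝ} (hu : 0 < u) : 0 < X u := by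
  refine lt_of_lt_of_le ?_ (hX.le u hu)
  have := hg.pos (-Real.log u)
  have := Real.sqrt_pos.2 hu
  positivity

theorem SlowGrowth.abs_sub_le (hg : SlowGrowth g M) {x c : ℝ} (hx : 0 ≤ x) (hxc : 0 ≤ x + c) :
    |g (x + c) - g x| ≤ g |c| := by
  rcases le_total 0 c with hc | hc
  · rw [abs_of_nonneg hc, abs_of_nonneg (sub_nonneg.2 (hg.mono (by linarith)))]
    linarith [hg.add_le x hx c hc]
  · rw [abs_of_nonpos hc, abs_sub_comm, abs_of_nonneg (sub_nonneg.2 (hg.mono (by linarith)))]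
    have := hg.add_le (x + c) hxc (-c) (by linarith)
    rw [add_neg_cancel_right] at this
    linarith

theorem tendsto_neg_log_nhdsGT_zero : Tendsto (fun s : ℝ => -Real.log s) (𝓝[>] 0) atTop :=
  tendsto_neg_atBot_atTop.comp Real.tendsto_log_nhdsGT_zero

theorem SlowGrowth.tendsto_neg_log (hg : SlowGrowth g M) (c : ℝ) :
    Tendsto (fun s => g (-Real.log s + c)) (𝓝[>] 0) atTop :=
  hg.top.comp (tendsto_atTop_add_const_right _ _ tendsto_neg_log_nhdsGT_zero)

theorem SlowGrowth.tendsto_const_div (hg : SlowGrowth g M) (A : ℝ) :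
    Tendsto (fun s => A / g (-Real.log s)) (𝓝[>] 0) (𝓝 0) := by
  simpa using (tendsto_const_nhds (x := A)).div_atTop (hg.tendsto_neg_log 0)

/-- Slow variation: by subadditivity a shift of the argument by c changes g by at most the constant
g|c|, while g itself tends to infinity. -/
theorem SlowGrowth.tendsto_ratio (hg : SlowGrowth g M) (c : ℝ) :
    Tendsto (fun s => g (-Real.log s + c) / g (-Real.log s)) (𝓝[>] 0) (𝓝 1) := by
  have h : Tendsto (fun s => g (-Real.log s + c) / g (-Real.log s) - 1) (𝓝[>] 0) (𝓝 0) := by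
    refine squeeze_zero_norm' ?_ (hg.tendsto_const_div (g |c|))
    filter_upwards [tendsto_neg_log_nhdsGT_zero.eventually_ge_atTop 0,
      tendsto_neg_log_nhdsGT_zero.eventually_ge_atTop (-c)] with s h1 h2
    have hp := hg.pos (-Real.log s)
    rw [div_sub_one hp.ne', norm_div, Real.norm_eq_abs, Real.norm_eq_abs, abs_of_pos hp]
    exact div_le_div_of_nonneg_right (hg.abs_sub_le h1 (by linarith)) hp.le
  simpa using h.add_const 1

/-- Since 1/3 < 1/e, this is the range of u in which the bound on g' over [1,∞) can be used at -log
u. -/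
theorem one_le_neg_log {u : ℝ} (hu : 0 < u) (hu' : u ≤ 1 / 3) : 1 ≤ -Real.log u := by
  rw [le_neg, Real.log_le_iff_le_exp hu]
  refine hu'.trans ?_
  rw [Real.exp_neg, one_div]
  exact inv_anti₀ (Real.exp_pos 1) (by linarith [Real.exp_one_lt_d9])

theorem SlowGrowth.tau_nonneg (hg : SlowGrowth g M) {s : ℝ} (hs : 0 ≤ s) : 0 ≤ tau g s :=
  div_nonneg hs (hg.pos _).le

theorem SlowGrowth.tendsto_tau (hg : SlowGrowth g M) : Tendsto (tau g) (𝓝[>] 0) (𝓝 0) := by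
  refine squeeze_zero' (g := id) ?_ ?_ (tendsto_id'.2 nhdsWithin_le_nhds)
  · filter_upwards [self_mem_nhdsWithin] with s hs using hg.tau_nonneg (le_of_lt hs)
  · filter_upwards [self_mem_nhdsWithin] with s hs
    exact div_le_self (le_of_lt hs) (hg.one_le _)

/-- The time density `g(-log u) / √u`. -/
noncomputable def kernel (g : ℝ → ℝ) (u : ℝ) : ℝ := g (-Real.log u) / √u

/-- The derivative of `kernel g`. -/
noncomputable def kernelDeriv (g : ℝ → ℝ) (u : ℝ) : ℝ :=
  -(g (-Real.log u) / 2 + deriv g (-Real.log u)) / (u * √u)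

theorem SlowGrowth.hasDerivAt_kernel (hg : SlowGrowth g M) {u : ℝ} (hu : 0 < u) (hu' : u < 1) :
    HasDerivAt (kernel g) (kernelDeriv g u) u := by
  have h1 : HasDerivAt (fun u => -Real.log u) (-u⁻¹) u := (Real.hasDerivAt_log hu.ne').neg
  have h2 := (hg.diff (-Real.log u) (by linarith [Real.log_neg hu hu'])).hasDerivAt.comp u h1
  have h3 := h2.div (Real.hasDerivAt_sqrt hu.ne') (Real.sqrt_pos.2 hu).ne'
  refine h3.congr_deriv ?_
  have h4 := Real.sqrt_pos.2 hu
  have h5 := Real.sq_sqrt hu.le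
  simp only [Function.comp, kernelDeriv]
  rw [h5]
  field_simp
  rw [h5]
  ring

theorem SlowGrowth.continuousOn_kernel (hg : SlowGrowth g M) : ContinuousOn (kernel g) (Ioi 0) := by
  refine ContinuousOn.div ?_ Real.continuous_sqrt.continuousOn
    fun u hu => (Real.sqrt_pos.2 hu).ne'
  exact hg.cont.comp_continuousOn
    (Real.continuousOn_log.mono fun u hu => ne_of_gt hu).neg

theorem SlowGrowth.kernel_pos (hg : SlowGrowth g M) {u : ℝ} (hu : 0 < u) : 0 < kernel g u :=
  div_pos (hg.pos _) (Real.sqrt_pos.2 hu)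

theorem SlowGrowth.measurable_kernel (hg : SlowGrowth g M) : Measurable (kernel g) :=
  (hg.cont.measurable.comp Real.measurable_log.neg).div Real.continuous_sqrt.measurable

theorem SlowGrowth.measurable_kernelDeriv (hg : SlowGrowth g M) : Measurable (kernelDeriv g) := by
  have h1 : Measurable fun u => g (-Real.log u) := hg.cont.measurable.comp Real.measurable_log.neg
  have h2 : Measurable fun u => deriv g (-Real.log u) :=
    (measurable_deriv g).comp Real.measurable_log.neg
  have h3 : Measurable fun u : ℝ => u * √u := by fun_prop
  exact ((h1.div_const 2).add h2).neg.div h3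

theorem SlowGrowth.abs_kernelDeriv_le (hg : SlowGrowth g M) {u : ℝ} (hu : 0 < u)
    (hu' : u ≤ 1 / 3) :
    |kernelDeriv g u| ≤ (1 / 2 + M) * g (-Real.log u) / (u * √u) := by
  have h1 := hg.one_le (-Real.log u)
  have h2 := hg.deriv_le _ (one_le_neg_log hu hu')
  have hp : 0 < u * √u := mul_pos hu (Real.sqrt_pos.2 hu)
  rw [kernelDeriv, abs_div, abs_of_pos hp, abs_neg]
  refine div_le_div_of_nonneg_right ((abs_add_le _ _).trans ?_) hp.le
  rw [abs_of_pos (by linarith)]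
  nlinarith [hg.nonneg_const]

theorem IsWidth.continuousOn (hX : IsWidth g X) : ContinuousOn X (Ioi 0) :=
  fun u hu => (hX.hasDerivAt u hu).continuousAt.continuousWithinAt

/-- A `C¹` function with bounded derivative, to be evaluated at the angle of a point. -/
structure IsAngular (P P' : ℝ → ℂ) (B : ℝ) : Prop where
  hasDerivAt : ∀ x, HasDerivAt P (P' x) x
  cont' : Continuous P'
  le : ∀ x, ‖P x‖ ≤ B
  le' : ∀ x, ‖P' x‖ ≤ B

variable {P P' : ℝ → ℂ} {B : ℝ}

theorem IsAngular.cont (hP : IsAngular P P' B) : Continuous P :=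
  continuous_iff_continuousAt.2 fun x => (hP.hasDerivAt x).continuousAt

theorem IsAngular.nonneg (hP : IsAngular P P' B) : 0 ≤ B := (norm_nonneg _).trans (hP.le 0)

theorem IsAngular.norm_smul_add_smul_le (hP : IsAngular P P' B) (a b x : ℝ) :
    ‖a • P x + b • P' x‖ ≤ B * (|a| + |b|) := by
  refine (norm_add_le _ _).trans ?_
  rw [norm_smul, norm_smul, Real.norm_eq_abs, Real.norm_eq_abs]
  nlinarith [hP.le x, hP.le' x, abs_nonneg a, abs_nonneg b]

theorem IsAngular.tendsto_smul_add_smul (hP : IsAngular P P' B) {ι : Type*} {l : Filter ι}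
    {a b x : ι → ℝ} {A : ℝ} (ha : Tendsto a l (𝓝 A)) (hb : Tendsto b l (𝓝 0))
    (hx : Tendsto x l (𝓝 0)) :
    Tendsto (fun i => a i • P (x i) + b i • P' (x i)) l (𝓝 (A • P 0)) := by
  have h1 := ha.smul ((hP.cont.tendsto 0).comp hx)
  have h2 := hb.smul ((hP.cont'.tendsto 0).comp hx)
  rw [zero_smul] at h2
  simpa using h1.add h2

theorem tendsto_arctan_zero {ι : Type*} {l : Filter ι} {x y : ι → ℝ}
    (hy : Tendsto y l (𝓝 0)) (h : ∀ᶠ i in l, |x i| ≤ y i) :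
    Tendsto (fun i => Real.arctan (x i)) l (𝓝 0) := by
  have h1 : Tendsto x l (𝓝 0) := squeeze_zero_norm' (by simpa using h) hy
  simpa [Function.comp_def] using (Real.continuous_arctan.tendsto 0).comp h1

theorem SlowGrowth.log_scaled {s w : ℝ} (hs : 0 < s) :
    -Real.log (s * (1 + w ^ 2)) = -Real.log s + -Real.log (1 + w ^ 2) := by
  rw [Real.log_mul hs.ne' (by positivity)]; ring

theorem mul_sqrt_scaled {s w : ℝ} (hs : 0 < s) :
    s * (1 + w ^ 2) * √(s * (1 + w ^ 2)) = s * √s * ((1 + w ^ 2) * √(1 + w ^ 2)) := by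
  rw [Real.sqrt_mul hs.le]; ring

theorem sqrt_mul_sq {s w : ℝ} (hs : 0 < s) : (√s * w) ^ 2 = s * w ^ 2 := by
  rw [mul_pow, Real.sq_sqrt hs.le]

theorem add_sqrt_mul_sq {s w : ℝ} (hs : 0 < s) : s + (√s * w) ^ 2 = s * (1 + w ^ 2) := by
  rw [sqrt_mul_sq hs]; ring

theorem hasDerivAt_sqrt_const_sub {s₀ s : ℝ} (hs : s < s₀) :
    HasDerivAt (fun σ => √(s₀ - σ)) (-(1 / (2 * √(s₀ - s)))) s := by
  have h := ((hasDerivAt_id s).const_sub s₀).sqrt (by simpa [sub_eq_zero] using hs.ne')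
  refine h.congr_deriv ?_
  simp only [id]; ring

/-- Passing from the Leibniz formula to the asymptotics of the derivative: the endpoint term is
negligible. -/
theorem tendsto_tau_smul_deriv (hg : SlowGrowth g M) {s₀ K : ℝ} (hs₀ : 0 < s₀)
    {φ I R : ℝ → ℂ} {l : ℂ}
    (hφ : ∀ s ∈ Ioo 0 s₀, HasDerivAt φ (I s + (-(1 / (2 * √(s₀ - s)))) • R s) s)
    (hR : ∀ᶠ s in 𝓝[>] 0, ‖R s‖ ≤ K)
    (hI : Tendsto (fun s => tau g s • I s) (𝓝[>] 0) (𝓝 l)) :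
    Tendsto (fun s => tau g s • deriv φ s) (𝓝[>] 0) (𝓝 l) := by
  have h1 : Tendsto (fun s => (-(1 / (2 * √(s₀ - s))))) (𝓝[>] 0)
      (𝓝 (-(1 / (2 * √(s₀ - 0))))) := by
    refine Tendsto.mono_left ?_ nhdsWithin_le_nhds
    have : ContinuousAt (fun s => (-(1 / (2 * √(s₀ - s))))) 0 := by
      refine (ContinuousAt.div continuousAt_const (by fun_prop) ?_).neg
      have := Real.sqrt_pos.2 hs₀
      simpa using this.ne'
    exact this.tendsto
  have h2 : Tendsto (fun s => (tau g s * (-(1 / (2 * √(s₀ - s))))) • R s) (𝓝[>] 0) (𝓝 0) := by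
    have h3 := hg.tendsto_tau.mul h1
    rw [zero_mul] at h3
    refine h3.zero_smul_isBoundedUnder_le ?_
    exact isBoundedUnder_of_eventually_le hR
  have h3 := hI.add h2
  rw [add_zero] at h3
  refine h3.congr' ?_
  filter_upwards [Ioo_mem_nhdsGT hs₀] with s hs
  rw [(hφ s hs).deriv, smul_add, smul_smul]

end ImperfectSaddle

/-! ### Differentiation and asymptotics in the right sector -/

namespace ImperfectSaddle

variable {g X : ℝ → ℝ} {M : ℝ} {P P' : ℝ → ℂ} {B : ℝ}

/-- The integrand of the passage integral through the right sector. -/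
noncomputable def rightIntegrand (g X : ℝ → ℝ) (P : ℝ → ℂ) (s v : ℝ) : ℂ :=
  kernel g (s + v ^ 2) • P (Real.arctan (v / X (s + v ^ 2)))

/-- The `P'`-coefficient of the `s`-derivative of `rightIntegrand`. -/
noncomputable def rightCoeff (g X : ℝ → ℝ) (u v : ℝ) : ℝ :=
  kernel g u * (-(v * kernel g u) / (X u ^ 2 + v ^ 2))

/-- The derivative of `rightIntegrand` in `s`. -/
noncomputable def rightIntegrandDeriv (g X : ℝ → ℝ) (P P' : ℝ → ℂ) (s v : ℝ) : ℂ :=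
  kernelDeriv g (s + v ^ 2) • P (Real.arctan (v / X (s + v ^ 2))) +
    rightCoeff g X (s + v ^ 2) v • P' (Real.arctan (v / X (s + v ^ 2)))

theorem hasDerivAt_rightIntegrand (hg : SlowGrowth g M) (hX : IsWidth g X)
    (hP : IsAngular P P' B) {s v : ℝ} (h0 : 0 < s + v ^ 2) (h1 : s + v ^ 2 < 1) :
    HasDerivAt (fun σ => rightIntegrand g X P σ v) (rightIntegrandDeriv g X P P' s v) s := by
  set u := s + v ^ 2 with hu
  have hXp := hX.pos hg h0
  have ha : HasDerivAt (fun u => Real.arctan (v / X u))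
      (-(v * kernel g u) / (X u ^ 2 + v ^ 2)) u := by
    have h2 : HasDerivAt (fun u => v / X u) _ u :=
      (hasDerivAt_const u v).div (hX.hasDerivAt u h0) hXp.ne'
    refine h2.arctan.congr_deriv ?_
    rw [kernel]
    field_simp
    ring
  have h3 := (hg.hasDerivAt_kernel h0 h1).smul ((hP.hasDerivAt _).scomp u ha)
  have h4 := h3.comp_add_const s (v ^ 2)
  refine h4.congr_deriv ?_
  rw [rightIntegrandDeriv, ← hu, rightCoeff, smul_smul, add_comm]
  rfl

theorem continuousOn_rightIntegrand (hg : SlowGrowth g M) (hX : IsWidth g X)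
    (hP : IsAngular P P' B) :
    ContinuousOn (Function.uncurry (rightIntegrand g X P)) {p : ℝ × ℝ | 0 < p.1 + p.2 ^ 2} := by
  have h1 : ContinuousOn (fun p : ℝ × ℝ => p.1 + p.2 ^ 2) {p : ℝ × ℝ | 0 < p.1 + p.2 ^ 2} := by
    fun_prop
  have h2 : ContinuousOn (fun p : ℝ × ℝ => X (p.1 + p.2 ^ 2)) {p : ℝ × ℝ | 0 < p.1 + p.2 ^ 2} :=
    hX.continuousOn.comp h1 fun p hp => hp
  refine (hg.continuousOn_kernel.comp h1 fun p hp => hp).smul ?_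
  exact hP.cont.comp_continuousOn (Real.continuous_arctan.comp_continuousOn
    (continuousOn_snd.div h2 fun p hp => (hX.pos hg hp).ne'))

theorem continuous_rightIntegrand (hg : SlowGrowth g M) (hX : IsWidth g X)
    (hP : IsAngular P P' B) {s : ℝ} (hs : 0 < s) : Continuous (rightIntegrand g X P s) := by
  rw [← continuousOn_univ]
  exact (continuousOn_rightIntegrand hg hX hP).comp (f := fun v : ℝ => (s, v)) (by fun_prop)
    fun v _ => show 0 < s + v ^ 2 by positivity

theorem measurable_rightIntegrandDeriv (hg : SlowGrowth g M) (hX : IsWidth g X)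
    (hP : IsAngular P P' B) {s : ℝ} (hs : 0 < s) :
    Measurable (rightIntegrandDeriv g X P P' s) := by
  have h1 : Measurable fun v : ℝ => s + v ^ 2 := by fun_prop
  have h2 : Measurable fun v : ℝ => X (s + v ^ 2) := by
    have : Continuous fun v : ℝ => X (s + v ^ 2) := by
      rw [← continuousOn_univ]
      exact hX.continuousOn.comp (by fun_prop) fun v _ => show 0 < s + v ^ 2 by positivity
    exact this.measurable
  have h3 : Measurable fun v : ℝ => Real.arctan (v / X (s + v ^ 2)) :=
    Real.measurable_arctan.comp (measurable_id.div h2)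
  have h4 := hg.measurable_kernel.comp h1
  have h5 := hg.measurable_kernelDeriv.comp h1
  have h6 : Measurable fun v : ℝ => rightCoeff g X (s + v ^ 2) v :=
    h4.mul ((measurable_id.mul h4).neg.div ((h2.pow_const 2).add (measurable_id.pow_const 2)))
  exact (h5.smul (hP.cont.measurable.comp h3)).add (h6.smul (hP.cont'.measurable.comp h3))

/-- The coefficient contains g², but the width bound puts 4u g² into the denominator, and no g is
left. It is thus smaller than the main term by a factor g and disappears after multiplication by τ.
-/
theorem abs_rightCoeff_le (hg : SlowGrowth g M) (hX : IsWidth g X) {u v : ℝ} (hu : 0 < u)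
    (hv : |v| ≤ √u) : |rightCoeff g X u v| ≤ 1 / 4 / (u * √u) := by
  have hXl := hX.le u hu
  have hg0 := hg.pos (-Real.log u)
  have hr := Real.sqrt_pos.2 hu
  have hru : √u ^ 2 = u := Real.sq_sqrt hu.le
  have hk : kernel g u * √u = g (-Real.log u) := div_mul_cancel₀ _ hr.ne'
  have hk0 := hg.kernel_pos hu
  have hX2 : 4 * u * g (-Real.log u) ^ 2 ≤ X u ^ 2 + v ^ 2 := by
    have : (2 * √u * g (-Real.log u)) ^ 2 ≤ X u ^ 2 := by gcongr
    nlinarith [sq_nonneg v]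
  have hpos : 0 < X u ^ 2 + v ^ 2 := lt_of_lt_of_le (by positivity) hX2
  rw [rightCoeff, abs_mul, abs_div, abs_neg, abs_mul, abs_of_pos hk0, abs_of_pos hpos,
    mul_div_assoc', div_le_div_iff₀ hpos (by positivity)]
  calc kernel g u * (|v| * kernel g u) * (u * √u)
      ≤ kernel g u * (√u * kernel g u) * (u * √u) := by gcongr
    _ = 1 / 4 * (4 * u * (kernel g u * √u) ^ 2) := by ring
    _ ≤ 1 / 4 * (X u ^ 2 + v ^ 2) := by rw [hk]; gcongr

/-- The level curve is wider than it is high by a factor of order g, so at this scale the orbit hugs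
the real axis and its angle tends to 0. -/
theorem abs_div_width_le (hg : SlowGrowth g M) (hX : IsWidth g X) {u v : ℝ} (hu : 0 < u)
    (hv : |v| ≤ √u) : |v / X u| ≤ 1 / g (-Real.log u) := by
  have hg0 := hg.pos (-Real.log u)
  have hr := Real.sqrt_pos.2 hu
  rw [abs_div, abs_of_pos (hX.pos hg hu), div_le_div_iff₀ (hX.pos hg hu) hg0]
  have := hX.le u hu
  have : |v| * g (-Real.log u) ≤ √u * g (-Real.log u) := by gcongr
  nlinarith [mul_pos hr hg0]

theorem norm_rightIntegrandDeriv_le (hg : SlowGrowth g M) (hX : IsWidth g X)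
    (hP : IsAngular P P' B) {s v : ℝ} (hs : 0 < s) (h1 : s + v ^ 2 ≤ 1 / 3) :
    ‖rightIntegrandDeriv g X P P' s v‖ ≤
      B * (1 + M) * g (-Real.log (s + v ^ 2)) / ((s + v ^ 2) * √(s + v ^ 2)) := by
  set u := s + v ^ 2 with hu
  have hu0 : 0 < u := by positivity
  have hr := Real.sqrt_pos.2 hu0
  refine (hP.norm_smul_add_smul_le _ _ _).trans ?_
  rw [mul_assoc, mul_div_assoc]
  refine mul_le_mul_of_nonneg_left ?_ hP.nonneg
  have hb : |v| ≤ √u := Real.abs_le_sqrt (by linarith)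
  refine (add_le_add (hg.abs_kernelDeriv_le hu0 h1) (abs_rightCoeff_le hg hX hu0 hb)).trans ?_
  rw [← add_div]
  refine div_le_div_of_nonneg_right ?_ (by positivity)
  nlinarith [hg.one_le (-Real.log u), hg.nonneg_const]

theorem hasDerivAt_integral_right (hg : SlowGrowth g M) (hX : IsWidth g X)
    (hP : IsAngular P P' B) {s₀ s : ℝ} (hs₀ : s₀ ≤ 1 / 4) (hs : s ∈ Ioo 0 s₀) :
    HasDerivAt (fun σ => ∫ v in (0 : ℝ)..√(s₀ - σ), rightIntegrand g X P σ v)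
      ((∫ v in (0 : ℝ)..√(s₀ - s), rightIntegrandDeriv g X P P' s v) +
        (-(1 / (2 * √(s₀ - s)))) • rightIntegrand g X P s √(s₀ - s)) s := by
  obtain ⟨hs1, hs2⟩ := hs
  have hpos : ∀ᶠ σ in 𝓝 s, 0 < σ := lt_mem_nhds hs1
  have hopen : IsOpen {p : ℝ × ℝ | 0 < p.1 + p.2 ^ 2} := isOpen_lt (by fun_prop) (by fun_prop)
  refine hasDerivAt_integral_of_moving_endpoint (hasDerivAt_sqrt_const_sub hs2) ?_ ?_ ?_ ?_
  · refine (continuousOn_rightIntegrand hg hX hP).continuousAt (hopen.mem_nhds ?_)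
    show 0 < s + √(s₀ - s) ^ 2
    positivity
  · set c := s / 2 with hc
    have hc0 : 0 < c := by positivity
    -- Since s₀ ≤ 1/4 and 1/4 + 1/12 = 1/3, the argument σ + v² stays in the range where the
    -- derivative bound holds. The lower limit c keeps it away from the singularity at 0.
    have hball : Ioo c (s + 1 / 12) ∈ 𝓝 s := Ioo_mem_nhds (by linarith) (by linarith)
    have hrange : ∀ v ∈ uIoc (0 : ℝ) √(s₀ - s), ∀ σ ∈ Ioo c (s + 1 / 12),
        c ≤ σ + v ^ 2 ∧ σ + v ^ 2 ≤ 1 / 3 := by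
      intro v hv σ hσ
      rw [uIoc_of_le (Real.sqrt_nonneg _)] at hv
      have h1 : v ^ 2 ≤ s₀ - s := by
        rw [← Real.sq_sqrt (show 0 ≤ s₀ - s by linarith)]
        exact pow_le_pow_left₀ hv.1.le hv.2 2
      constructor
      · nlinarith [sq_nonneg v, hσ.1]
      · linarith [hσ.2]
    refine (intervalIntegral.hasDerivAt_integral_of_dominated_loc_of_deriv_le
      (bound := fun _ => B * (1 + M) * g (-Real.log c) / (c * √c)) hball ?_ ?_ ?_ ?_ ?_ ?_).2
    · filter_upwards [hpos] with σ hσ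
      exact (continuous_rightIntegrand hg hX hP hσ).aestronglyMeasurable
    · exact (continuous_rightIntegrand hg hX hP hs1).intervalIntegrable _ _
    · exact (measurable_rightIntegrandDeriv hg hX hP hs1).aestronglyMeasurable
    · refine Eventually.of_forall fun v hv σ hσ => ?_
      obtain ⟨h1, h2⟩ := hrange v hv σ hσ
      refine (norm_rightIntegrandDeriv_le hg hX hP (hc0.trans hσ.1) h2).trans ?_
      have h3 : g (-Real.log (σ + v ^ 2)) ≤ g (-Real.log c) :=
        hg.mono (neg_le_neg (Real.log_le_log hc0 h1))
      have hB := hP.nonneg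
      have hM := hg.nonneg_const
      have h4 := (hg.pos (-Real.log c)).le
      have h5 : 0 ≤ σ + v ^ 2 := hc0.le.trans h1
      gcongr
    · exact intervalIntegrable_const
    · refine Eventually.of_forall fun v hv σ hσ => ?_
      obtain ⟨h1, h2⟩ := hrange v hv σ hσ
      exact hasDerivAt_rightIntegrand hg hX hP (hc0.trans_le h1) (by linarith)
  · filter_upwards [hpos] with σ hσ
    exact (continuous_rightIntegrand hg hX hP hσ).intervalIntegrable _ _
  · filter_upwards [hpos] with σ hσ
    exact (continuous_rightIntegrand hg hX hP hσ).intervalIntegrable _ _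

theorem integrableOn_inv_one_add_sq_mul_sqrt :
    IntegrableOn (fun w : ℝ => ((1 + w ^ 2) * √(1 + w ^ 2))⁻¹) (Ioi 0) :=
  integrableOn_Ioi_deriv_of_nonneg' (fun w _ => hasDerivAt_div_sqrt_one_add_sq w)
    (fun w _ => by positivity) tendsto_div_sqrt_one_add_sq

theorem tendsto_log_mul_atTop {c : ℝ} (hc : 0 < c) :
    Tendsto (fun s => -Real.log (s * c)) (𝓝[>] 0) atTop := by
  refine (tendsto_atTop_add_const_right _ (-Real.log c) tendsto_neg_log_nhdsGT_zero).congr' ?_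
  filter_upwards [self_mem_nhdsWithin] with s hs
  rw [Real.log_mul (ne_of_gt hs) hc.ne']
  ring

/-- With v = √s w one has u = s(1 + w²). The factor τ(s)√s = s^(3/2)/g(-log s) cancels the power of
s in u^(3/2) and leaves the limit profile (1 + w²)^(-3/2). -/
theorem SlowGrowth.tau_mul_sqrt_scaled (hg : SlowGrowth g M) {s w x : ℝ} (hs : 0 < s) :
    tau g s * √s * (x / ((s * (1 + w ^ 2)) * √(s * (1 + w ^ 2)))) =
      ((1 + w ^ 2) * √(1 + w ^ 2))⁻¹ * (x / g (-Real.log s)) := by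
  have h1 := Real.sqrt_pos.2 hs
  have h2 : 0 < √(1 + w ^ 2) := Real.sqrt_pos.2 (by positivity)
  have h3 := hg.pos (-Real.log s)
  rw [mul_sqrt_scaled hs, tau]
  field_simp

theorem tendsto_integral_right (hg : SlowGrowth g M) (hX : IsWidth g X)
    (hP : IsAngular P P' B) {s₀ : ℝ} (hs₀ : 0 < s₀) (hs₀' : s₀ ≤ 1 / 4) :
    Tendsto (fun s => tau g s • ∫ v in (0 : ℝ)..√(s₀ - s), rightIntegrandDeriv g X P P' s v)
      (𝓝[>] 0) (𝓝 ((-(1 / 2) : ℝ) • P 0)) := by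
  refine tendsto_integral_of_rescaled
    (bnd := fun w => B * (1 + M) * ((1 + w ^ 2) * √(1 + w ^ 2))⁻¹) hs₀ ?_ ?_ ?_ ?_ ?_
  · filter_upwards [self_mem_nhdsWithin] with s hs
    exact (measurable_rightIntegrandDeriv hg hX hP hs).aestronglyMeasurable
  · intro w hw
    set q := ((1 + w ^ 2) * √(1 + w ^ 2))⁻¹ with hq
    have hw0 : 0 < 1 + w ^ 2 := by positivity
    have hvle : ∀ s > 0, |√s * w| ≤ √(s * (1 + w ^ 2)) := fun s hs =>
      Real.abs_le_sqrt (by rw [sqrt_mul_sq hs]; nlinarith)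
    have key : Tendsto (fun s => (tau g s * √s * kernelDeriv g (s * (1 + w ^ 2))) •
          P (Real.arctan (√s * w / X (s * (1 + w ^ 2)))) +
        (tau g s * √s * rightCoeff g X (s * (1 + w ^ 2)) (√s * w)) •
          P' (Real.arctan (√s * w / X (s * (1 + w ^ 2))))) (𝓝[>] 0)
        (𝓝 ((q * -(1 / 2 + 0)) • P 0)) := by
      refine hP.tendsto_smul_add_smul ?_ ?_ ?_
      -- The g/2 part of the kernel derivative gives 1/2 by slow variation. The g' part is bounded
      -- by M and is killed by the division by g(-log s).
      · have h1 := ((hg.tendsto_ratio (-Real.log (1 + w ^ 2))).div_const 2)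
        have h2 : Tendsto (fun s => deriv g (-Real.log (s * (1 + w ^ 2))) / g (-Real.log s))
            (𝓝[>] 0) (𝓝 0) := by
          refine squeeze_zero_norm' ?_ (hg.tendsto_const_div M)
          filter_upwards [(tendsto_log_mul_atTop hw0).eventually_ge_atTop 1] with s hs
          have hp := hg.pos (-Real.log s)
          rw [norm_div, Real.norm_eq_abs, Real.norm_eq_abs, abs_of_pos hp]
          exact div_le_div_of_nonneg_right (hg.deriv_le _ hs) hp.le
        refine ((h1.add h2).neg.const_mul q).congr' ?_
        filter_upwards [self_mem_nhdsWithin] with s hs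
        rw [kernelDeriv, hg.tau_mul_sqrt_scaled hs, ← SlowGrowth.log_scaled hs]
        ring
      · have h1 := (hg.tendsto_const_div (1 / 4)).const_mul q
        rw [mul_zero] at h1
        refine squeeze_zero_norm' ?_ h1
        filter_upwards [self_mem_nhdsWithin] with s hs
        have hs' : (0 : ℝ) < s := hs
        rw [norm_mul, Real.norm_eq_abs, Real.norm_eq_abs,
          abs_of_nonneg (mul_nonneg (hg.tau_nonneg hs'.le) (Real.sqrt_nonneg _)),
          ← hg.tau_mul_sqrt_scaled hs]
        exact mul_le_mul_of_nonneg_left (abs_rightCoeff_le hg hX (by positivity) (hvle s hs))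
          (mul_nonneg (hg.tau_nonneg hs'.le) (Real.sqrt_nonneg _))
      · refine tendsto_arctan_zero (y := fun s => 1 / g (-Real.log (s * (1 + w ^ 2)))) ?_ ?_
        · exact (tendsto_const_nhds (x := (1 : ℝ))).div_atTop
            (hg.top.comp (tendsto_log_mul_atTop hw0))
        · filter_upwards [self_mem_nhdsWithin] with s hs
          have hs' : (0 : ℝ) < s := hs
          exact abs_div_width_le hg hX (by positivity) (hvle s hs)
    rw [add_zero, ← smul_smul] at key
    refine key.congr' ?_
    filter_upwards [self_mem_nhdsWithin] with s hs
    rw [rightIntegrandDeriv, add_sqrt_mul_sq hs, smul_add, smul_smul, smul_smul]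
  · filter_upwards [Ioo_mem_nhdsGT hs₀] with s hs w hw hws
    have hs1 := hs.1
    have hw0 : 0 < 1 + w ^ 2 := by positivity
    have hu : s * (1 + w ^ 2) ≤ 1 / 3 := by
      rw [← add_sqrt_mul_sq hs1]
      have := pow_le_pow_left₀ (by positivity) hws 2
      rw [Real.sq_sqrt (by linarith [hs.2])] at this
      linarith
    have hτ : 0 ≤ tau g s * √s := mul_nonneg (hg.tau_nonneg hs1.le) (Real.sqrt_nonneg _)
    have h1 := norm_rightIntegrandDeriv_le hg hX hP hs1 (v := √s * w)
      (by rw [add_sqrt_mul_sq hs1]; exact hu)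
    rw [add_sqrt_mul_sq hs1] at h1
    rw [norm_smul, Real.norm_eq_abs, abs_of_nonneg hτ]
    refine (mul_le_mul_of_nonneg_left h1 hτ).trans ?_
    rw [hg.tau_mul_sqrt_scaled hs1, mul_comm]
    refine mul_le_mul_of_nonneg_right ?_ (by positivity)
    rw [mul_div_assoc]
    refine mul_le_of_le_one_right (mul_nonneg hP.nonneg (by linarith [hg.nonneg_const])) ?_
    rw [div_le_one (hg.pos _)]
    -- Here u = s(1 + w²) is at least s, so the ratio g(-log u)/g(-log s) is at most 1 and the
    -- dominating function needs no correction.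
    refine hg.mono (neg_le_neg (Real.log_le_log hs1 ?_))
    nlinarith [sq_nonneg w]
  · intro w
    have := hP.nonneg
    have := hg.nonneg_const
    positivity
  · exact integrableOn_inv_one_add_sq_mul_sqrt.const_mul _

theorem tendsto_tau_smul_deriv_right (hg : SlowGrowth g M) (hX : IsWidth g X)
    (hP : IsAngular P P' B) {s₀ : ℝ} (hs₀ : 0 < s₀) (hs₀' : s₀ ≤ 1 / 4) :
    Tendsto (fun s => tau g s •
        deriv (fun σ => ∫ v in (0 : ℝ)..√(s₀ - σ), rightIntegrand g X P σ v) s)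
      (𝓝[>] 0) (𝓝 ((-(1 / 2) : ℝ) • P 0)) := by
  refine tendsto_tau_smul_deriv hg (K := kernel g s₀ * B) hs₀
    (fun s hs => hasDerivAt_integral_right hg hX hP hs₀' hs) ?_
    (tendsto_integral_right hg hX hP hs₀ hs₀')
  filter_upwards [Ioo_mem_nhdsGT hs₀] with s hs
  -- At the endpoint s + v² equals s₀, so the density there does not depend on s.
  rw [rightIntegrand, Real.sq_sqrt (by linarith [hs.2]), add_sub_cancel, norm_smul,
    Real.norm_eq_abs, abs_of_pos (hg.kernel_pos hs₀)]
  exact mul_le_mul_of_nonneg_left (hP.le _) (hg.kernel_pos hs₀).le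

end ImperfectSaddle

/-! ### Differentiation and asymptotics in the upper sector -/

namespace ImperfectSaddle

variable {g X : ℝ → ℝ} {M : ℝ} {P P' : ℝ → ℂ} {B : ℝ}

/-- The integrand of the passage integral through the upper sector. -/
noncomputable def upperIntegrand (g X : ℝ → ℝ) (P : ℝ → ℂ) (s v : ℝ) : ℂ :=
  (g (-Real.log (v ^ 2)) / √(s + v ^ 2)) • P (Real.arctan (√(s + v ^ 2) / X (v ^ 2)))

/-- The `P`-coefficient of the `s`-derivative of `upperIntegrand`. -/
noncomputable def upperCoeff (g : ℝ → ℝ) (u v : ℝ) : ℝ :=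
  -(1 / 2 * g (-Real.log (v ^ 2))) / (u * √u)

/-- The `P'`-coefficient of the `s`-derivative of `upperIntegrand`. -/
noncomputable def upperCoeff' (g X : ℝ → ℝ) (u v : ℝ) : ℝ :=
  g (-Real.log (v ^ 2)) / √u * (X (v ^ 2) / (2 * √u * (X (v ^ 2) ^ 2 + u)))

/-- The derivative of `upperIntegrand` in `s`. -/
noncomputable def upperIntegrandDeriv (g X : ℝ → ℝ) (P P' : ℝ → ℂ) (s v : ℝ) : ℂ :=
  upperCoeff g (s + v ^ 2) v • P (Real.arctan (√(s + v ^ 2) / X (v ^ 2))) +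
    upperCoeff' g X (s + v ^ 2) v • P' (Real.arctan (√(s + v ^ 2) / X (v ^ 2)))

theorem hasDerivAt_upperIntegrand (hg : SlowGrowth g M) (hX : IsWidth g X)
    (hP : IsAngular P P' B) {s v : ℝ} (hs : 0 < s) (hv : 0 < v) :
    HasDerivAt (fun σ => upperIntegrand g X P σ v) (upperIntegrandDeriv g X P P' s v) s := by
  set u := s + v ^ 2 with hu
  have h0 : 0 < u := by positivity
  have hXp := hX.pos hg (show 0 < v ^ 2 by positivity)
  have hr := Real.sqrt_pos.2 h0
  have hr2 := Real.sq_sqrt h0.le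
  have ha : HasDerivAt (fun u => Real.arctan (√u / X (v ^ 2)))
      (X (v ^ 2) / (2 * √u * (X (v ^ 2) ^ 2 + u))) u := by
    refine ((Real.hasDerivAt_sqrt h0.ne').div_const (X (v ^ 2))).arctan.congr_deriv ?_
    field_simp
    rw [hr2]
  have hb : HasDerivAt (fun u => g (-Real.log (v ^ 2)) / √u) (upperCoeff g u v) u := by
    refine ((hasDerivAt_const u (g (-Real.log (v ^ 2)))).div
      (Real.hasDerivAt_sqrt h0.ne') hr.ne').congr_deriv ?_
    rw [upperCoeff]
    field_simp
    rw [hr2]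
    ring
  have h3 := hb.smul ((hP.hasDerivAt _).scomp u ha)
  have h4 := h3.comp_add_const s (v ^ 2)
  refine h4.congr_deriv ?_
  rw [upperIntegrandDeriv, ← hu, upperCoeff', smul_smul, add_comm]
  rfl

theorem SlowGrowth.continuousOn_log_sq (hg : SlowGrowth g M) :
    ContinuousOn (fun v : ℝ => g (-Real.log (v ^ 2))) (Ioi 0) := by
  refine hg.cont.comp_continuousOn (ContinuousOn.neg (ContinuousOn.log (by fun_prop) ?_))
  intro v hv
  exact pow_ne_zero 2 (ne_of_gt hv)

theorem continuousOn_upperIntegrand (hg : SlowGrowth g M) (hX : IsWidth g X)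
    (hP : IsAngular P P' B) :
    ContinuousOn (Function.uncurry (upperIntegrand g X P)) {p : ℝ × ℝ | 0 < p.1 ∧ 0 < p.2} := by
  have h1 : ContinuousOn (fun p : ℝ × ℝ => √(p.1 + p.2 ^ 2)) {p : ℝ × ℝ | 0 < p.1 ∧ 0 < p.2} := by
    fun_prop
  have h2 : ContinuousOn (fun p : ℝ × ℝ => X (p.2 ^ 2)) {p : ℝ × ℝ | 0 < p.1 ∧ 0 < p.2} :=
    hX.continuousOn.comp (by fun_prop) fun p hp => pow_pos hp.2 2
  have h3 : ContinuousOn (fun p : ℝ × ℝ => g (-Real.log (p.2 ^ 2)))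
      {p : ℝ × ℝ | 0 < p.1 ∧ 0 < p.2} :=
    hg.continuousOn_log_sq.comp continuousOn_snd fun p hp => hp.2
  refine (h3.div h1 fun p hp => ?_).smul (hP.cont.comp_continuousOn
    (Real.continuous_arctan.comp_continuousOn (h1.div h2 fun p hp => ?_)))
  · have := hp.1
    exact (Real.sqrt_pos.2 (by positivity)).ne'
  · exact (hX.pos hg (pow_pos hp.2 2)).ne'

theorem continuousOn_upperIntegrand_right (hg : SlowGrowth g M) (hX : IsWidth g X)
    (hP : IsAngular P P' B) {s : ℝ} (hs : 0 < s) :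
    ContinuousOn (upperIntegrand g X P s) (Ioi 0) :=
  (continuousOn_upperIntegrand hg hX hP).comp (f := fun v : ℝ => (s, v)) (by fun_prop)
    fun _ hv => ⟨hs, hv⟩

theorem continuousOn_upperIntegrandDeriv (hg : SlowGrowth g M) (hX : IsWidth g X)
    (hP : IsAngular P P' B) {s : ℝ} (hs : 0 < s) :
    ContinuousOn (upperIntegrandDeriv g X P P' s) (Ioi 0) := by
  have h1 : ContinuousOn (fun v : ℝ => √(s + v ^ 2)) (Ioi 0) := by fun_prop
  have h2 : ContinuousOn (fun v : ℝ => X (v ^ 2)) (Ioi 0) :=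
    hX.continuousOn.comp (by fun_prop) fun v hv => show 0 < v ^ 2 from pow_pos hv 2
  have h3 := hg.continuousOn_log_sq
  have hr : ∀ v : ℝ, 0 < √(s + v ^ 2) := fun v => Real.sqrt_pos.2 (by positivity)
  have h4 : ContinuousOn (fun v => Real.arctan (√(s + v ^ 2) / X (v ^ 2))) (Ioi 0) :=
    Real.continuous_arctan.comp_continuousOn
      (h1.div h2 fun v hv => (hX.pos hg (pow_pos hv 2)).ne')
  have h5 : ContinuousOn (fun v => upperCoeff g (s + v ^ 2) v) (Ioi 0) := by
    refine (continuousOn_const.mul h3).neg.div (ContinuousOn.mul (by fun_prop) h1) fun v _ => ?_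
    have := hr v
    positivity
  have h6 : ContinuousOn (fun v => upperCoeff' g X (s + v ^ 2) v) (Ioi 0) := by
    refine (h3.div h1 fun v _ => (hr v).ne').mul (h2.div ((continuousOn_const.mul h1).mul
      ((h2.pow 2).add (by fun_prop))) fun v _ => ?_)
    have := hr v
    positivity
  exact (h5.smul (hP.cont.comp_continuousOn h4)).add (h6.smul (hP.cont'.comp_continuousOn h4))

/-- Obtained from 2X√u ≤ X² + u alone. The bound has the same shape as the main coefficient, so it
serves for domination. -/
theorem abs_upperCoeff'_le (hg : SlowGrowth g M) (hX : IsWidth g X) {u v : ℝ} (hu : 0 < u)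
    (hv : 0 < v) : |upperCoeff' g X u v| ≤ 1 / 4 * g (-Real.log (v ^ 2)) / (u * √u) := by
  have hXp := hX.pos hg (show 0 < v ^ 2 by positivity)
  have hg0 := hg.pos (-Real.log (v ^ 2))
  have hr := Real.sqrt_pos.2 hu
  have hru : √u ^ 2 = u := Real.sq_sqrt hu.le
  rw [upperCoeff', abs_of_pos (by positivity), div_mul_div_comm,
    div_le_div_iff₀ (by positivity) (by positivity)]
  have h1 : 2 * X (v ^ 2) * √u ≤ X (v ^ 2) ^ 2 + u := by
    nlinarith [sq_nonneg (X (v ^ 2) - √u)]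
  calc g (-Real.log (v ^ 2)) * X (v ^ 2) * (u * √u)
      = 1 / 2 * g (-Real.log (v ^ 2)) * u * (2 * X (v ^ 2) * √u) := by ring
    _ ≤ 1 / 2 * g (-Real.log (v ^ 2)) * u * (X (v ^ 2) ^ 2 + u) := by gcongr
    _ = 1 / 4 * g (-Real.log (v ^ 2)) * (√u * (2 * √u * (X (v ^ 2) ^ 2 + u))) := by
        linear_combination (-(1 / 2) * g (-Real.log (v ^ 2)) * (X (v ^ 2) ^ 2 + u)) * hru

/-- Here the width bound absorbs g, at the price of a singularity at v = 0. It serves for the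
pointwise limit at fixed w, where the absent factor g makes the term with P' vanish. -/
theorem abs_upperCoeff'_le' (hg : SlowGrowth g M) (hX : IsWidth g X) {u v : ℝ} (hu : 0 < u)
    (hv : 0 < v) : |upperCoeff' g X u v| ≤ 1 / (4 * u * v) := by
  have hXp := hX.pos hg (show 0 < v ^ 2 by positivity)
  have hg0 := hg.pos (-Real.log (v ^ 2))
  have hr := Real.sqrt_pos.2 hu
  have hru : √u ^ 2 = u := Real.sq_sqrt hu.le
  have hXl := hX.le (v ^ 2) (by positivity)
  rw [Real.sqrt_sq hv.le] at hXl
  rw [upperCoeff', abs_of_pos (by positivity), div_mul_div_comm,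
    div_le_div_iff₀ (by positivity) (by positivity)]
  calc g (-Real.log (v ^ 2)) * X (v ^ 2) * (4 * u * v)
      = 2 * u * X (v ^ 2) * (2 * v * g (-Real.log (v ^ 2))) := by ring
    _ ≤ 2 * u * X (v ^ 2) * X (v ^ 2) := by gcongr
    _ ≤ 2 * u * (X (v ^ 2) ^ 2 + u) := by nlinarith
    _ = 1 * (√u * (2 * √u * (X (v ^ 2) ^ 2 + u))) := by
        linear_combination (-2 * (X (v ^ 2) ^ 2 + u)) * hru

theorem norm_upperIntegrandDeriv_le (hg : SlowGrowth g M) (hX : IsWidth g X)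
    (hP : IsAngular P P' B) {s v : ℝ} (hs : 0 < s) (hv : 0 < v) :
    ‖upperIntegrandDeriv g X P P' s v‖ ≤
      B * g (-Real.log (v ^ 2)) / ((s + v ^ 2) * √(s + v ^ 2)) := by
  set u := s + v ^ 2 with hu
  have hu0 : 0 < u := by positivity
  have hr := Real.sqrt_pos.2 hu0
  have hg0 := hg.pos (-Real.log (v ^ 2))
  refine (hP.norm_smul_add_smul_le _ _ _).trans ?_
  rw [mul_div_assoc]
  refine mul_le_mul_of_nonneg_left ?_ hP.nonneg
  refine (add_le_add le_rfl (abs_upperCoeff'_le hg hX hu0 hv)).trans ?_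
  rw [upperCoeff, neg_div, abs_neg, abs_of_pos (by positivity), ← add_div]
  refine div_le_div_of_nonneg_right ?_ (by positivity)
  linarith

/-- Unlike on the right, the argument of g is unbounded near v = 0 even for fixed s > 0. Linear
growth of g reduces the question to the integrability of log v. -/
theorem SlowGrowth.intervalIntegrable_log_sq (hg : SlowGrowth g M) {b : ℝ} (hb : 0 ≤ b)
    (hb1 : b ≤ 1) : IntervalIntegrable (fun v => g (-Real.log (v ^ 2))) volume 0 b := by
  have h1 : IntervalIntegrable (fun v => M * (1 + -2 * Real.log v)) volume 0 b :=
    ((intervalIntegrable_const).add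
      (intervalIntegral.intervalIntegrable_log'.const_mul _)).const_mul _
  refine h1.mono_fun' ?_ ?_
  · rw [uIoc_of_le hb]
    exact (hg.continuousOn_log_sq.mono Ioc_subset_Ioi_self).aestronglyMeasurable measurableSet_Ioc
  · rw [uIoc_of_le hb]
    filter_upwards [ae_restrict_mem measurableSet_Ioc] with v hv
    have h2 : Real.log v ≤ 0 := Real.log_nonpos hv.1.le (hv.2.trans hb1)
    rw [Real.norm_eq_abs, abs_of_pos (hg.pos _)]
    refine (hg.linear _ ?_).trans (le_of_eq ?_)
    · rw [Real.log_pow]; push_cast; linarith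
    · rw [Real.log_pow]; push_cast; ring

theorem intervalIntegrable_upperIntegrand (hg : SlowGrowth g M) (hX : IsWidth g X)
    (hP : IsAngular P P' B) {s b : ℝ} (hs : 0 < s) (hb : 0 ≤ b) (hb1 : b ≤ 1) :
    IntervalIntegrable (upperIntegrand g X P s) volume 0 b := by
  refine ((hg.intervalIntegrable_log_sq hb hb1).mul_const (B / √s)).mono_fun' ?_ ?_
  · rw [uIoc_of_le hb]
    exact ((continuousOn_upperIntegrand_right hg hX hP hs).mono
      Ioc_subset_Ioi_self).aestronglyMeasurable measurableSet_Ioc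
  · refine Eventually.of_forall fun v => ?_
    show ‖upperIntegrand g X P s v‖ ≤ _
    have h1 := hg.pos (-Real.log (v ^ 2))
    have h2 := Real.sqrt_pos.2 hs
    have h3 : √s ≤ √(s + v ^ 2) := Real.sqrt_le_sqrt (by nlinarith [sq_nonneg v])
    have h4 := hP.le (Real.arctan (√(s + v ^ 2) / X (v ^ 2)))
    have h5 := hP.nonneg
    rw [upperIntegrand, norm_smul, Real.norm_eq_abs, abs_of_nonneg (by positivity)]
    calc g (-Real.log (v ^ 2)) / √(s + v ^ 2) * ‖P (Real.arctan (√(s + v ^ 2) / X (v ^ 2)))‖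
        ≤ g (-Real.log (v ^ 2)) / √s * B := by gcongr
      _ = g (-Real.log (v ^ 2)) * (B / √s) := by ring

theorem hasDerivAt_integral_upper (hg : SlowGrowth g M) (hX : IsWidth g X)
    (hP : IsAngular P P' B) {s₀ s : ℝ} (hs₀ : s₀ ≤ 1 / 4) (hs : s ∈ Ioo 0 s₀) :
    HasDerivAt (fun σ => ∫ v in (0 : ℝ)..√(s₀ - σ), upperIntegrand g X P σ v)
      ((∫ v in (0 : ℝ)..√(s₀ - s), upperIntegrandDeriv g X P P' s v) +
        (-(1 / (2 * √(s₀ - s)))) • upperIntegrand g X P s √(s₀ - s)) s := by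
  obtain ⟨hs1, hs2⟩ := hs
  have hpos : ∀ᶠ σ in 𝓝 s, 0 < σ := lt_mem_nhds hs1
  have hopen : IsOpen {p : ℝ × ℝ | 0 < p.1 ∧ 0 < p.2} :=
    (isOpen_lt continuous_const continuous_fst).inter (isOpen_lt continuous_const continuous_snd)
  have hY : 0 < √(s₀ - s) := Real.sqrt_pos.2 (by linarith)
  have hY1 : √(s₀ - s) ≤ 1 := Real.sqrt_le_one.2 (by linarith)
  refine hasDerivAt_integral_of_moving_endpoint (hasDerivAt_sqrt_const_sub hs2) ?_ ?_ ?_ ?_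
  · exact (continuousOn_upperIntegrand hg hX hP).continuousAt (hopen.mem_nhds ⟨hs1, hY⟩)
  · set c := s / 2 with hc
    have hc0 : 0 < c := by positivity
    have hball : Ioi c ∈ 𝓝 s := Ioi_mem_nhds (by linarith)
    refine (intervalIntegral.hasDerivAt_integral_of_dominated_loc_of_deriv_le
      (bound := fun v => B * g (-Real.log (v ^ 2)) / (c * √c)) hball ?_ ?_ ?_ ?_ ?_ ?_).2
    · filter_upwards [hpos] with σ hσ
      exact (intervalIntegrable_iff.1
        (intervalIntegrable_upperIntegrand hg hX hP hσ hY.le hY1)).aestronglyMeasurable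
    · exact intervalIntegrable_upperIntegrand hg hX hP hs1 hY.le hY1
    · rw [uIoc_of_le hY.le]
      exact ((continuousOn_upperIntegrandDeriv hg hX hP hs1).mono
        Ioc_subset_Ioi_self).aestronglyMeasurable measurableSet_Ioc
    · refine Eventually.of_forall fun v hv σ hσ => ?_
      rw [uIoc_of_le hY.le] at hv
      have hσ' : c < σ := hσ
      refine (norm_upperIntegrandDeriv_le hg hX hP (hc0.trans hσ') hv.1).trans ?_
      have h3 : c ≤ σ + v ^ 2 := by nlinarith [sq_nonneg v]
      have hB := hP.nonneg
      have h4 := (hg.pos (-Real.log (v ^ 2))).le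
      have h5 : 0 ≤ σ + v ^ 2 := hc0.le.trans h3
      gcongr
    · exact ((hg.intervalIntegrable_log_sq hY.le hY1).const_mul B).div_const _
    · refine Eventually.of_forall fun v hv σ hσ => ?_
      rw [uIoc_of_le hY.le] at hv
      exact hasDerivAt_upperIntegrand hg hX hP (hc0.trans hσ) hv.1
  · filter_upwards [hpos] with σ hσ
    exact intervalIntegrable_upperIntegrand hg hX hP hσ hY.le hY1
  · filter_upwards [hpos, gt_mem_nhds hs2] with σ hσ hσ'
    refine ((continuousOn_upperIntegrand_right hg hX hP hσ).mono ?_).intervalIntegrable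
    intro v hv
    exact (lt_min hY (Real.sqrt_pos.2 (by linarith))).trans_le hv.1

theorem tendsto_integral_upper (hg : SlowGrowth g M) (hX : IsWidth g X)
    (hP : IsAngular P P' B) {s₀ : ℝ} (hs₀ : 0 < s₀) (hs₀' : s₀ ≤ 1 / 4) :
    Tendsto (fun s => tau g s • ∫ v in (0 : ℝ)..√(s₀ - s), upperIntegrandDeriv g X P P' s v)
      (𝓝[>] 0) (𝓝 ((-(1 / 2) : ℝ) • P 0)) := by
  have hlog : ∀ {s w : ℝ}, 0 < s → 0 < w →
      -Real.log ((√s * w) ^ 2) = -Real.log s + -Real.log (w ^ 2) := by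
    intro s w hs hw
    rw [sqrt_mul_sq hs, Real.log_mul hs.ne' (by positivity)]
    ring
  refine tendsto_integral_of_rescaled
    -- For w < 1 the argument -log(s w²) exceeds -log s, and the ratio of values of g is no longer
    -- at most 1. The indicator term pays for this, and it is integrable because g(-log w²) is
    -- integrable on (0,1].
    (bnd := fun w => B * (((1 + w ^ 2) * √(1 + w ^ 2))⁻¹ +
      (Ioc (0 : ℝ) 1).indicator (fun w => g (-Real.log (w ^ 2))) w)) hs₀ ?_ ?_ ?_ ?_ ?_
  · filter_upwards [self_mem_nhdsWithin] with s hs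
    exact ((continuousOn_upperIntegrandDeriv hg hX hP hs).mono
        Ioc_subset_Ioi_self).aestronglyMeasurable measurableSet_Ioc
  · intro w hw
    set q := ((1 + w ^ 2) * √(1 + w ^ 2))⁻¹ with hq
    have hw0 : 0 < 1 + w ^ 2 := by positivity
    have hw' : 0 < w := hw
    have key : Tendsto (fun s => (tau g s * √s * upperCoeff g (s * (1 + w ^ 2)) (√s * w)) •
          P (Real.arctan (√(s * (1 + w ^ 2)) / X ((√s * w) ^ 2))) +
        (tau g s * √s * upperCoeff' g X (s * (1 + w ^ 2)) (√s * w)) •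
          P' (Real.arctan (√(s * (1 + w ^ 2)) / X ((√s * w) ^ 2)))) (𝓝[>] 0)
        (𝓝 ((q * -(1 / 2 * 1)) • P 0)) := by
      refine hP.tendsto_smul_add_smul ?_ ?_ ?_
      · have h1 := ((hg.tendsto_ratio (-Real.log (w ^ 2))).const_mul (1 / 2))
        refine (h1.neg.const_mul q).congr' ?_
        filter_upwards [self_mem_nhdsWithin] with s hs
        rw [upperCoeff, hg.tau_mul_sqrt_scaled hs, hlog hs hw]
        ring
      · refine squeeze_zero_norm' ?_ (hg.tendsto_const_div (1 / (4 * (1 + w ^ 2) * w)))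
        filter_upwards [self_mem_nhdsWithin] with s hs
        have hs' : (0 : ℝ) < s := hs
        have hr := Real.sqrt_pos.2 hs'
        have hp := hg.pos (-Real.log s)
        rw [norm_mul, Real.norm_eq_abs, Real.norm_eq_abs,
          abs_of_nonneg (mul_nonneg (hg.tau_nonneg hs'.le) (Real.sqrt_nonneg _))]
        refine (mul_le_mul_of_nonneg_left (abs_upperCoeff'_le' hg hX (by positivity)
          (by positivity)) (mul_nonneg (hg.tau_nonneg hs'.le) (Real.sqrt_nonneg _))).trans ?_
        rw [tau]
        apply le_of_eq
        field_simp
      · refine tendsto_arctan_zero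
          (y := fun s => √(1 + w ^ 2) / (2 * w) / g (-Real.log s + -Real.log (w ^ 2))) ?_ ?_
        · exact tendsto_const_nhds.div_atTop (hg.tendsto_neg_log _)
        · filter_upwards [self_mem_nhdsWithin] with s hs
          have hs' : (0 : ℝ) < s := hs
          have hr := Real.sqrt_pos.2 hs'
          have hXl := hX.le ((√s * w) ^ 2) (by positivity)
          have hXp := hX.pos hg (show 0 < (√s * w) ^ 2 by positivity)
          rw [hlog hs' hw, Real.sqrt_sq (by positivity)] at hXl
          have hp := hg.pos (-Real.log s + -Real.log (w ^ 2))
          rw [abs_of_nonneg (by positivity), Real.sqrt_mul hs'.le, div_div,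
            div_le_div_iff₀ hXp (by positivity)]
          have := Real.sqrt_pos.2 hw0
          calc √s * √(1 + w ^ 2) * (2 * w * g (-Real.log s + -Real.log (w ^ 2)))
              = √(1 + w ^ 2) * (2 * (√s * w) * g (-Real.log s + -Real.log (w ^ 2))) := by ring
            _ ≤ _ := by gcongr
    rw [mul_one, ← smul_smul] at key
    refine key.congr' ?_
    filter_upwards [self_mem_nhdsWithin] with s hs
    rw [upperIntegrandDeriv, add_sqrt_mul_sq hs, smul_add, smul_smul, smul_smul]
  · filter_upwards [Ioo_mem_nhdsGT hs₀] with s hs w hw hws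
    have hs1 := hs.1
    have hw' : 0 < w := hw
    have hw0 : 0 < 1 + w ^ 2 := by positivity
    have hr1 : 1 ≤ √(1 + w ^ 2) := Real.one_le_sqrt.2 (by nlinarith [sq_nonneg w])
    have hr := Real.sqrt_pos.2 hs1
    have hp := hg.pos (-Real.log s)
    have hlogs : 0 ≤ -Real.log s := by
      linarith [Real.log_nonpos hs1.le (by linarith [hs.2] : s ≤ 1)]
    have hτ : 0 ≤ tau g s * √s := mul_nonneg (hg.tau_nonneg hs1.le) (Real.sqrt_nonneg _)
    have h1 := norm_upperIntegrandDeriv_le hg hX hP hs1 (v := √s * w) (by positivity)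
    rw [add_sqrt_mul_sq hs1] at h1
    rw [norm_smul, Real.norm_eq_abs, abs_of_nonneg hτ]
    refine (mul_le_mul_of_nonneg_left h1 hτ).trans ?_
    rw [hg.tau_mul_sqrt_scaled hs1, mul_div_assoc, mul_left_comm]
    refine mul_le_mul_of_nonneg_left ?_ hP.nonneg
    have hq0 : 0 ≤ ((1 + w ^ 2) * √(1 + w ^ 2))⁻¹ := by positivity
    have hq1 : ((1 + w ^ 2) * √(1 + w ^ 2))⁻¹ ≤ 1 :=
      inv_le_one_of_one_le₀ (by nlinarith [sq_nonneg w])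
    rw [hlog hs1 hw]
    rcases le_or_gt w 1 with hw1 | hw1
    · rw [indicator_of_mem (show w ∈ Ioc (0 : ℝ) 1 from ⟨hw, hw1⟩)]
      have hlw : 0 ≤ -Real.log (w ^ 2) := by
        linarith [Real.log_nonpos (sq_nonneg w) (pow_le_one₀ hw'.le hw1)]
      have hgw := hg.pos (-Real.log (w ^ 2))
      -- Subadditivity splits the numerator, and g(-log s) ≥ 1 bounds the second quotient.
      have h2 : g (-Real.log s + -Real.log (w ^ 2)) / g (-Real.log s) ≤
          1 + g (-Real.log (w ^ 2)) := by
        rw [div_le_iff₀ hp]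
        nlinarith [hg.add_le _ hlogs _ hlw, hg.one_le (-Real.log s)]
      nlinarith [mul_le_mul_of_nonneg_left h2 hq0, mul_le_mul_of_nonneg_right hq1 hgw.le]
    · rw [indicator_of_notMem (fun h => absurd h.2 (not_le.2 hw1)), add_zero]
      refine mul_le_of_le_one_right hq0 ((div_le_one hp).2 (hg.mono ?_))
      linarith [Real.log_nonneg (one_le_pow₀ hw1.le : 1 ≤ w ^ 2)]
  · intro w
    have h1 := hP.nonneg
    have h2 : 0 ≤ (Ioc (0 : ℝ) 1).indicator (fun w => g (-Real.log (w ^ 2))) w :=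
      indicator_nonneg (fun w _ => (hg.pos _).le) w
    positivity
  · refine (integrableOn_inv_one_add_sq_mul_sqrt.add ?_).const_mul B
    have h1 := (hg.intervalIntegrable_log_sq zero_le_one le_rfl)
    rw [intervalIntegrable_iff_integrableOn_Ioc_of_le zero_le_one] at h1
    exact ((integrable_indicator_iff measurableSet_Ioc).2 h1).integrableOn

theorem tendsto_tau_smul_deriv_upper (hg : SlowGrowth g M) (hX : IsWidth g X)
    (hP : IsAngular P P' B) {s₀ : ℝ} (hs₀ : 0 < s₀) (hs₀' : s₀ ≤ 1 / 4) :
    Tendsto (fun s => tau g s •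
        deriv (fun σ => ∫ v in (0 : ℝ)..√(s₀ - σ), upperIntegrand g X P σ v) s)
      (𝓝[>] 0) (𝓝 ((-(1 / 2) : ℝ) • P 0)) := by
  refine tendsto_tau_smul_deriv hg (K := g (-Real.log (s₀ / 2)) / √s₀ * B) hs₀
    (fun s hs => hasDerivAt_integral_upper hg hX hP hs₀' hs) ?_
    (tendsto_integral_upper hg hX hP hs₀ hs₀')
  -- At the endpoint v² = s₀ - s. Restricting to s < s₀/2 keeps it above s₀/2, which bounds g(-log
  -- v²).
  filter_upwards [Ioo_mem_nhdsGT (half_pos hs₀)] with s hs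
  rw [upperIntegrand, Real.sq_sqrt (by linarith [hs.2]), add_sub_cancel, norm_smul,
    Real.norm_eq_abs, abs_of_nonneg (div_nonneg (hg.pos _).le (Real.sqrt_nonneg _))]
  have h1 : g (-Real.log (s₀ - s)) ≤ g (-Real.log (s₀ / 2)) :=
    hg.mono (neg_le_neg (Real.log_le_log (by linarith) (by linarith [hs.2])))
  have h2 := hg.pos (-Real.log (s₀ / 2))
  have h3 := hP.le (Real.arctan (√s₀ / X (s₀ - s)))
  gcongr

end ImperfectSaddle

/-! ### Growth of an admissible `g` and the inverse branch of the profile -/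

namespace ImperfectSaddle

variable {g H₁ : ℝ → ℝ}

/-- Concavity at 1, written as the convex combination of 0 and x with weights 1 - 1/x and 1/x. -/
theorem sub_le_mul_of_concaveOn {g : ℝ → ℝ} (hg : ConcaveOn ℝ (Ici 0) g) {x : ℝ} (hx : 1 ≤ x) :
    g x - g 0 ≤ x * (g 1 - g 0) := by
  have hx0 : 0 < x := by linarith
  have h := hg.2 (mem_Ici.2 le_rfl) (mem_Ici.2 hx0.le)
    (sub_nonneg.2 (inv_le_one_of_one_le₀ hx)) (inv_nonneg.2 hx0.le) (by ring)
  simp only [smul_eq_mul, mul_zero, zero_add, inv_mul_cancel₀ hx0.ne'] at h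
  have h2 := mul_le_mul_of_nonneg_left h hx0.le
  have h3 : x * ((1 - x⁻¹) * g 0 + x⁻¹ * g x) = (x - 1) * g 0 + g x := by field_simp
  rw [h3] at h2
  linarith

theorem IsAdmissible.slowGrowth (hg : IsAdmissible g) :
    SlowGrowth (fun x => g (max x 0)) (g 1) := by
  have hmem : ∀ x : ℝ, max x 0 ∈ Ici (0 : ℝ) := fun x => mem_Ici.2 (le_max_right _ _)
  have h01 : 1 ≤ g 1 := by
    have := hg.mono (mem_Ici.2 le_rfl) (mem_Ici.2 zero_le_one) zero_le_one
    rwa [hg.zero] at this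
  have hdiff : ∀ x > 0, DifferentiableAt ℝ g x := fun x hx =>
    (hg.smooth.contDiffAt (Ici_mem_nhds hx)).differentiableAt (by simp)
  have heq : ∀ x > 0, (fun x => g (max x 0)) =ᶠ[𝓝 x] g := fun x hx => by
    filter_upwards [lt_mem_nhds hx] with y hy
    rw [max_eq_left (le_of_lt hy)]
  have hmono : Monotone fun x => g (max x 0) := fun x y hxy =>
    hg.mono (hmem x) (hmem y) (max_le_max_right 0 hxy)
  have hlin : ∀ c ≥ 0, g c ≤ g 1 * (1 + c) := by
    intro c hc
    rcases le_total c 1 with h | h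
    · have := hg.mono (mem_Ici.2 hc) (mem_Ici.2 zero_le_one) h
      nlinarith
    · have := sub_le_mul_of_concaveOn hg.concave h
      rw [hg.zero] at this
      nlinarith
  refine ⟨?_, hmono, ?_, ?_, ?_, ?_, ?_, ?_⟩
  · rw [← continuousOn_univ]
    exact hg.smooth.continuousOn.comp (by fun_prop) fun x _ => hmem x
  · intro x
    rw [← hg.zero]
    exact hg.mono (mem_Ici.2 le_rfl) (hmem x) (hmem x)
  · exact fun x hx => (hdiff x hx).congr_of_eventuallyEq (heq x hx)
  · intro x hx
    have hx0 : 0 < x := by linarith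
    rw [abs_of_nonneg hmono.deriv_nonneg, (heq x hx0).deriv_eq]
    have h1 := (hasDerivAt_iff_tendsto_slope.1 (hdiff x hx0).hasDerivAt).mono_left
      (nhdsWithin_mono x (s := Ioi x) fun y hy => ne_of_gt hy)
    refine le_of_tendsto h1 ?_
    filter_upwards [self_mem_nhdsWithin] with y hy
    have hy' : x < y := hy
    rw [slope_def_field]
    -- Chord slopes of a concave function decrease, so any slope to the right of x is at most the
    -- slope over [0,x], and for x ≥ 1 this is at most g(1) - g(0).
    refine (hg.concave.slope_anti_adjacent (mem_Ici.2 le_rfl) (mem_Ici.2 (hx0.trans hy').le)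
      hx0 hy').trans ?_
    rw [sub_zero, div_le_iff₀ hx0]
    have := sub_le_mul_of_concaveOn hg.concave hx
    rw [hg.zero] at *
    nlinarith
  · intro x hx c hc
    rw [max_eq_left hx, max_eq_left hc, max_eq_left (add_nonneg hx hc)]
    rcases (add_nonneg hx hc).eq_or_lt with h | h
    · have hx' : x = 0 := by linarith
      have hc' : c = 0 := by linarith
      subst hx' hc'
      rw [add_zero, hg.zero]; norm_num
    -- Both x and c are convex combinations of 0 and x + c with exchanged weights. Adding the two
    -- inequalities gives g(0) + g(x + c) ≤ g(x) + g(c).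
    · have h1 := hg.concave.2 (mem_Ici.2 le_rfl) (mem_Ici.2 h.le) (div_nonneg hc h.le)
        (div_nonneg hx h.le) (by field_simp; ring)
      have h2 := hg.concave.2 (mem_Ici.2 le_rfl) (mem_Ici.2 h.le) (div_nonneg hx h.le)
        (div_nonneg hc h.le) (by field_simp)
      simp only [smul_eq_mul, mul_zero, zero_add, div_mul_cancel₀ _ h.ne', hg.zero] at h1 h2
      have h3 : c / (x + c) = 1 - x / (x + c) := by field_simp; ring
      rw [h3] at h1 h2
      linarith
  · intro c hc
    rw [max_eq_left hc]
    exact hlin c hc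
  · refine hg.unbounded.congr' ?_
    filter_upwards [eventually_ge_atTop 0] with x hx
    rw [max_eq_left hx]

theorem IsProfile.continuousOn (h : IsProfile g H₁) : ContinuousOn H₁ (Icc (-1) 1) :=
  h.contDiffOn.continuousOn

theorem IsProfile.hasDerivAt (h : IsProfile g H₁) {x : ℝ} (hx : x ∈ Ioo (-1 : ℝ) 1) :
    HasDerivAt H₁ (deriv H₁ x) x :=
  ((h.contDiffOn.contDiffAt (Icc_mem_nhds hx.1 hx.2)).differentiableAt
    (by norm_num)).hasDerivAt

theorem IsProfile.deriv_pos (h : IsProfile g H₁) {x : ℝ} (hx : x ∈ Ioo (0 : ℝ) 1) :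
    0 < deriv H₁ x := by
  have h1 := h.unimodal x ⟨by linarith [hx.1], hx.2.le⟩ hx.1.ne'
  rw [derivWithin_of_mem_nhds (Icc_mem_nhds (by linarith [hx.1]) hx.2)] at h1
  exact pos_of_mul_pos_right h1 hx.1.le

theorem IsProfile.deriv_neg (h : IsProfile g H₁) {x : ℝ} (hx : x ∈ Ioo (-1 : ℝ) 1) :
    deriv H₁ (-x) = -deriv H₁ x := by
  have h1 : (fun y => H₁ (-y)) =ᶠ[𝓝 x] H₁ := by
    filter_upwards [Icc_mem_nhds hx.1 hx.2] with y hy using h.even y hy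
  rw [← h1.deriv_eq, deriv_comp_neg, neg_neg]

theorem IsProfile.strictMonoOn (h : IsProfile g H₁) : StrictMonoOn H₁ (Icc 0 1) := by
  refine strictMonoOn_of_deriv_pos (convex_Icc 0 1)
    (h.continuousOn.mono (Icc_subset_Icc_left (by norm_num))) fun x hx => ?_
  rw [interior_Icc] at hx
  exact h.deriv_pos hx

theorem IsProfile.surjOn (h : IsProfile g H₁) : SurjOn H₁ (Icc 0 1) (Icc 0 (H₁ 1)) := by
  have := intermediate_value_Icc (zero_le_one' ℝ)
    (h.continuousOn.mono (Icc_subset_Icc_left (by norm_num)))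
  rwa [h.zero] at this

theorem IsProfile.apply_inverse (h : IsProfile g H₁) {u : ℝ} (hu : u ∈ Icc 0 (H₁ 1)) :
    H₁ (inverseBranch H₁ u) = u := Function.invFunOn_eq (h.surjOn hu)

theorem IsProfile.inverse_mem (h : IsProfile g H₁) {u : ℝ} (hu : u ∈ Icc 0 (H₁ 1)) :
    inverseBranch H₁ u ∈ Icc (0 : ℝ) 1 := Function.invFunOn_mem (h.surjOn hu)

theorem IsProfile.mem_range (h : IsProfile g H₁) {x : ℝ} (hx : x ∈ Icc (0 : ℝ) 1) :
    H₁ x ∈ Icc 0 (H₁ 1) := by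
  constructor
  · rw [← h.zero]
    exact h.strictMonoOn.monotoneOn ⟨le_rfl, zero_le_one⟩ hx hx.1
  · exact h.strictMonoOn.monotoneOn hx ⟨zero_le_one, le_rfl⟩ hx.2

theorem IsProfile.inverse_apply (h : IsProfile g H₁) {x : ℝ} (hx : x ∈ Icc (0 : ℝ) 1) :
    inverseBranch H₁ (H₁ x) = x :=
  h.strictMonoOn.injOn (h.inverse_mem (h.mem_range hx)) hx (h.apply_inverse (h.mem_range hx))

theorem IsProfile.inverse_strictMonoOn (h : IsProfile g H₁) :
    StrictMonoOn (inverseBranch H₁) (Icc 0 (H₁ 1)) := by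
  intro u hu v hv huv
  by_contra hle
  have := h.strictMonoOn.monotoneOn (h.inverse_mem hv) (h.inverse_mem hu) (not_lt.1 hle)
  rw [h.apply_inverse hu, h.apply_inverse hv] at this
  linarith

theorem IsProfile.inverse_zero (h : IsProfile g H₁) : inverseBranch H₁ 0 = 0 := by
  have := h.inverse_apply (x := 0) ⟨le_rfl, zero_le_one⟩
  rwa [h.zero] at this

theorem IsProfile.inverse_pos (h : IsProfile g H₁) {u : ℝ} (hu : u ∈ Ioc 0 (H₁ 1)) :
    0 < inverseBranch H₁ u := by
  have := h.inverse_strictMonoOn ⟨le_rfl, hu.1.le.trans hu.2⟩ ⟨hu.1.le, hu.2⟩ hu.1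
  rwa [h.inverse_zero] at this

theorem IsProfile.inverse_hasDerivAt (h : IsProfile g H₁) {u : ℝ} (hu : u ∈ Ioo 0 (H₁ 1)) :
    HasDerivAt (inverseBranch H₁) (g (-Real.log u) / √u) u :=
  (h.inverse_deriv u ⟨hu.1, hu.2.le⟩).hasDerivAt (Icc_mem_nhds hu.1 hu.2)

theorem IsProfile.inverse_continuousOn (h : IsProfile g H₁) :
    ContinuousOn (inverseBranch H₁) (Ioc 0 (H₁ 1)) := fun u hu =>
  ((h.inverse_deriv u hu).mono Ioc_subset_Icc_self).continuousWithinAt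

/-- A nonnegative function with derivative at least `c / √u` is at least `2 c √u`. -/
theorem two_mul_sqrt_le_of_le_deriv {X X' : ℝ → ℝ} {b c : ℝ} (hb : 0 < b)
    (hcont : ContinuousOn X (Ioc 0 b)) (hd : ∀ u ∈ Ioo 0 b, HasDerivAt X (X' u) u)
    (hle : ∀ u ∈ Ioo 0 b, c / √u ≤ X' u) (h0 : ∀ᶠ u in 𝓝[>] 0, 0 ≤ X u) :
    2 * c * √b ≤ X b := by
  have hmono : MonotoneOn (fun u => X u - 2 * c * √u) (Ioc 0 b) := by
    have hder : ∀ u ∈ Ioo 0 b, HasDerivAt (fun u => X u - 2 * c * √u)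
        (X' u - 2 * c * (1 / (2 * √u))) u := fun u hu =>
      (hd u hu).sub ((Real.hasDerivAt_sqrt hu.1.ne').const_mul _)
    refine monotoneOn_of_deriv_nonneg (convex_Ioc 0 b)
      (hcont.sub (by fun_prop)) ?_ ?_
    · rw [interior_Ioc]
      exact fun u hu => (hder u hu).differentiableAt.differentiableWithinAt
    · rw [interior_Ioc]
      intro u hu
      rw [(hder u hu).deriv]
      have := hle u hu
      have h2 : 2 * c * (1 / (2 * √u)) = c / √u := by ring
      linarith
  have hlim : Tendsto (fun u : ℝ => -(2 * c * √u)) (𝓝[>] 0) (𝓝 (-(2 * c * √0))) :=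
    (Continuous.tendsto (by fun_prop) 0).mono_left nhdsWithin_le_nhds
  have : -(2 * c * √0) ≤ X b - 2 * c * √b := by
    refine le_of_tendsto hlim ?_
    filter_upwards [h0, Ioo_mem_nhdsGT hb] with u hu1 hu2
    have := hmono ⟨hu2.1, hu2.2.le⟩ ⟨hb, le_rfl⟩ hu2.2.le
    simp only at this
    linarith
  simpa using this

theorem IsAdmissible.one_le (hg : IsAdmissible g) {x : ℝ} (hx : 0 ≤ x) : 1 ≤ g x := by
  rw [← hg.zero]; exact hg.mono (mem_Ici.2 le_rfl) (mem_Ici.2 hx) hx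

theorem IsProfile.top_pos (h : IsProfile g H₁) : 0 < H₁ 1 := by
  rw [← h.zero]
  exact h.strictMonoOn ⟨le_rfl, zero_le_one⟩ ⟨zero_le_one, le_rfl⟩ one_pos

/-- As g ≥ 1, the inverse branch is at least 2√u. If H₁(1) > 1/4 it would already reach 1 at u =
1/4, although it increases strictly to 1 at H₁(1). Hence -log u > 0 on the whole range, where the
constant extension of g agrees with g, and there is room below 1/3. -/
theorem IsProfile.top_le (hg : IsAdmissible g) (h : IsProfile g H₁) : H₁ 1 ≤ 1 / 4 := by
  by_contra hlt
  rw [not_le] at hlt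
  have h1 : 2 * 1 * √(1 / 4) ≤ inverseBranch H₁ (1 / 4) := by
    refine two_mul_sqrt_le_of_le_deriv (by norm_num)
      (h.inverse_continuousOn.mono (Ioc_subset_Ioc_right hlt.le))
      (fun u hu => h.inverse_hasDerivAt ⟨hu.1, hu.2.trans hlt⟩) (fun u hu => ?_) ?_
    · refine div_le_div_of_nonneg_right (hg.one_le ?_) (Real.sqrt_nonneg _)
      linarith [Real.log_nonpos hu.1.le (by linarith [hu.2])]
    · filter_upwards [Ioo_mem_nhdsGT h.top_pos] with u hu
      exact (h.inverse_pos ⟨hu.1, hu.2.le⟩).le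
  have h2 := h.inverse_strictMonoOn ⟨by norm_num, hlt.le⟩ ⟨h.top_pos.le, le_rfl⟩ hlt
  rw [h.inverse_apply ⟨zero_le_one, le_rfl⟩] at h2
  rw [show (1 / 4 : ℝ) = (1 / 2) ^ 2 by norm_num, Real.sqrt_sq (by norm_num)] at h1
  norm_num at h1 h2
  linarith

/-- The inverse branch on `(0, s₀]` extends to a width function on `(0,∞)`. -/
theorem IsProfile.exists_isWidth (hg : IsAdmissible g) (h : IsProfile g H₁) {x₀ : ℝ}
    (hx₀ : x₀ ∈ Ioc (0 : ℝ) 1) :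
    ∃ X : ℝ → ℝ, IsWidth (fun x => g (max x 0)) X ∧
      ∀ u ∈ Ioc 0 (H₁ x₀), X u = inverseBranch H₁ u := by
  have hG := hg.slowGrowth
  set G : ℝ → ℝ := fun x => g (max x 0) with hGdef
  have hx₀' : x₀ ∈ Icc (0 : ℝ) 1 := ⟨hx₀.1.le, hx₀.2⟩
  set s₀ := H₁ x₀ with hs₀
  have hs₀1 : s₀ ≤ H₁ 1 := (h.mem_range hx₀').2
  have hs₀pos : 0 < s₀ := by
    rw [← h.zero]; exact h.strictMonoOn ⟨le_rfl, zero_le_one⟩ hx₀' hx₀.1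
  have hkint : ∀ a b : ℝ, 0 < a → 0 < b → IntervalIntegrable (kernel G) volume a b :=
    fun a b ha hb => (hG.continuousOn_kernel.mono fun v hv =>
      (lt_min ha hb).trans_le hv.1).intervalIntegrable
  -- The primitive is normalized at s₀, where the inverse branch takes the value x₀, because the
  -- density is singular at 0.
  set X : ℝ → ℝ := fun u => x₀ + ∫ t in s₀..u, kernel G t with hX
  have hXd : ∀ u > 0, HasDerivAt X (G (-Real.log u) / √u) u := fun u hu =>
    (intervalIntegral.integral_hasDerivAt_right (hkint _ _ hs₀pos hu)
      (hG.continuousOn_kernel.stronglyMeasurableAtFilter isOpen_Ioi u hu)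
      (hG.continuousOn_kernel.continuousAt (Ioi_mem_nhds hu))).const_add x₀
  have hXeq : ∀ u ∈ Ioc 0 s₀, X u = inverseBranch H₁ u := by
    intro u hu
    have h1 : ∫ t in u..s₀, kernel G t = inverseBranch H₁ s₀ - inverseBranch H₁ u := by
      refine intervalIntegral.integral_eq_sub_of_hasDerivAt_of_le hu.2
        (h.inverse_continuousOn.mono fun t ht => ⟨hu.1.trans_le ht.1, ht.2.trans hs₀1⟩)
        (fun t ht => ?_) (hkint _ _ hu.1 hs₀pos)
      have ht0 : 0 < t := hu.1.trans ht.1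
      have ht1 : t < H₁ 1 := ht.2.trans_le hs₀1
      have := h.inverse_hasDerivAt ⟨ht0, ht1⟩
      rwa [← max_eq_left (a := -Real.log t) (b := 0)] at this
      have := h.top_le hg
      linarith [Real.log_nonpos ht0.le (by linarith : t ≤ 1)]
    rw [h.inverse_apply hx₀'] at h1
    simp only [hX]
    rw [intervalIntegral.integral_symm, h1]
    ring
  refine ⟨X, ⟨hXd, fun u hu => ?_⟩, hXeq⟩
  -- For t < u monotonicity gives g(-log t) ≥ g(-log u), so the constant c can be the value at the
  -- right end.
  have := two_mul_sqrt_le_of_le_deriv (X := X) (c := G (-Real.log u)) hu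
    (fun t ht => (hXd t ht.1).continuousAt.continuousWithinAt) (fun t ht => hXd t ht.1)
    (fun t ht => div_le_div_of_nonneg_right (hG.mono (neg_le_neg (Real.log_le_log ht.1 ht.2.le)))
      (Real.sqrt_nonneg _)) ?_
  · linarith
  · filter_upwards [Ioo_mem_nhdsGT hs₀pos] with t ht
    rw [hXeq t ⟨ht.1, ht.2.le⟩]
    exact (h.inverse_pos ⟨ht.1, ht.2.le.trans hs₀1⟩).le

end ImperfectSaddle

/-! ### Branches of the root and projection of the flow by z ↦ z^m -/

namespace ImperfectSaddle

variable {g H₁ : ℝ → ℝ} {m j : ℕ}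

theorem zeta_pow_natCast (m j : ℕ) :
    zeta m ^ j = Complex.exp (Complex.I * (Real.pi * j / m)) := by
  rw [zeta, ← Complex.exp_nat_mul]
  congr 1
  ring

theorem zeta_pow_pow (hm : m ≠ 0) (j : ℕ) : (zeta m ^ j) ^ m = (-1) ^ j := by
  have hm' : (m : ℂ) ≠ 0 := Nat.cast_ne_zero.2 hm
  rw [← pow_mul, mul_comm, pow_mul, zeta, ← Complex.exp_nat_mul,
    mul_div_cancel₀ _ hm', Complex.exp_pi_mul_I]

theorem rootBranch_pow (hm : m ≠ 0) (j : ℕ) (ω : ℂ) : rootBranch m j ω ^ m = (-1) ^ j * ω := by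
  rw [rootBranch, mul_pow, zeta_pow_pow hm, one_div, Complex.cpow_nat_inv_pow ω hm]

/-- Since ζ^m = -1, the m-th power inverts G_j only up to the sign (-1)^j. With the sign restored,
every sector of a given parity projects to one and the same base sector. -/
theorem neg_one_pow_mul_rootBranch_pow (hm : m ≠ 0) (j : ℕ) (ω : ℂ) :
    (-1) ^ j * rootBranch m j ω ^ m = ω := by
  rw [rootBranch_pow hm, ← mul_assoc, ← mul_pow]; simp

theorem rootBranch_eq (m j : ℕ) {ω : ℂ} (hω : ω ≠ 0) :
    rootBranch m j ω = ((‖ω‖ ^ (1 / m : ℝ) : ℝ) : ℂ) *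
      Complex.exp (Complex.I * ((Real.pi * j + ω.arg) / m : ℝ)) := by
  rw [rootBranch, zeta_pow_natCast, Complex.cpow_def_of_ne_zero hω, Complex.log,
    Complex.ofReal_cpow (norm_nonneg _),
    Complex.cpow_def_of_ne_zero (by simpa using hω), ← Complex.ofReal_log (norm_nonneg _),
    ← Complex.exp_add, ← Complex.exp_add]
  congr 1
  push_cast
  ring

theorem differentiableAt_rootBranch {ω : ℂ} (hω : ω ∈ Complex.slitPlane) :
    DifferentiableAt ℂ (rootBranch m j) ω := by
  unfold rootBranch
  exact (DifferentiableAt.cpow differentiableAt_id (differentiableAt_const _) hω).const_mul _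

theorem rootBranch_ne_zero (hm : m ≠ 0) {ω : ℂ} (hω : ω ≠ 0) : rootBranch m j ω ≠ 0 := by
  intro h
  have := neg_one_pow_mul_rootBranch_pow hm j ω
  rw [h, zero_pow hm, mul_zero] at this
  exact hω this.symm

/-- The Hamiltonian vector field of `simpleHamiltonian H₁`. -/
noncomputable def simpleField (H₁ : ℝ → ℝ) (ω : ℂ) : ℂ := ⟨2 * ω.im, deriv H₁ ω.re⟩

/-- The factor `|m z^(m-1)|²` by which `z ↦ z^m` changes the speed of the flow. -/
noncomputable def speed (m : ℕ) (z : ℂ) : ℝ := ‖(m : ℂ) * z ^ (m - 1)‖ ^ 2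

theorem speed_pos (hm : m ≠ 0) {z : ℂ} (hz : z ≠ 0) : 0 < speed m z := by
  have hm' : (m : ℂ) ≠ 0 := Nat.cast_ne_zero.2 hm
  have := norm_pos_iff.2 (mul_ne_zero hm' (pow_ne_zero (m - 1) hz))
  rw [speed]; positivity

theorem continuous_speed : Continuous (speed m) := by
  unfold speed; fun_prop

theorem hasFDerivAt_simpleHamiltonian {ω : ℂ} (h : HasDerivAt H₁ (deriv H₁ ω.re) ω.re) :
    HasFDerivAt (simpleHamiltonian H₁)
      (-(deriv H₁ ω.re • Complex.reCLM) + (2 * ω.im) • Complex.imCLM) ω := by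
  have h1 : HasFDerivAt (fun ω : ℂ => H₁ ω.re) (deriv H₁ ω.re • Complex.reCLM) ω :=
    h.comp_hasFDerivAt ω Complex.reCLM.hasFDerivAt
  have h2 : HasFDerivAt (fun ω : ℂ => ω.im ^ 2) ((2 * ω.im) • Complex.imCLM) ω := by
    simpa using Complex.imCLM.hasFDerivAt.pow 2 (x := ω)
  exact h1.neg.add h2

/-- Chain rule for ∂/∂z̄ under a holomorphic map p: the derivative of H̃ ∘ p is the conjugate of p'
times the derivative of H̃ at p. -/
theorem hamiltonianField_hamiltonian {z : ℂ}
    (h : HasDerivAt H₁ (deriv H₁ (z ^ m).re) (z ^ m).re) :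
    hamiltonianField (hamiltonian H₁ m) z =
      starRingEnd ℂ ((m : ℂ) * z ^ (m - 1)) * simpleField H₁ (z ^ m) := by
  have h1 : HasFDerivAt (fun z : ℂ => z ^ m)
      ((ContinuousLinearMap.toSpanSingleton ℂ ((m : ℂ) * z ^ (m - 1))).restrictScalars ℝ) z :=
    (hasDerivAt_pow m z).hasFDerivAt.restrictScalars ℝ
  have h2 : HasFDerivAt (hamiltonian H₁ m) _ z := (hasFDerivAt_simpleHamiltonian h).comp z h1
  rw [hamiltonianField, dbar, h2.fderiv]
  set c := (m : ℂ) * z ^ (m - 1)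
  apply Complex.ext <;>
  · simp [simpleField]
    ring

/-- As H₁ is even, the field of the simple saddle is odd, so the sign (-1)^j is compatible with the
flow. -/
theorem neg_one_pow_mul_simpleField (j : ℕ) {ω : ℂ} (h : deriv H₁ (-ω.re) = -deriv H₁ ω.re) :
    simpleField H₁ ((-1) ^ j * ω) = (-1) ^ j * simpleField H₁ ω := by
  rcases neg_one_pow_eq_or ℂ j with hj | hj <;> rw [hj]
  · simp
  · apply Complex.ext <;> simp [simpleField, h]

theorem abs_re_neg_one_pow_mul (j : ℕ) (ω : ℂ) : |((-1) ^ j * ω).re| = |ω.re| := by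
  rcases neg_one_pow_eq_or ℂ j with hj | hj <;> rw [hj] <;> simp

theorem abs_im_neg_one_pow_mul (j : ℕ) (ω : ℂ) : |((-1) ^ j * ω).im| = |ω.im| := by
  rcases neg_one_pow_eq_or ℂ j with hj | hj <;> rw [hj] <;> simp

/-- The field of the multi-saddle projects to a multiple of the field of the simple saddle. -/
theorem IsProfile.mul_hamiltonianField (h : IsProfile g H₁) (j : ℕ) {z : ℂ}
    (hz : |(z ^ m).re| < 1) :
    (-1) ^ j * ((m : ℂ) * z ^ (m - 1) * hamiltonianField (hamiltonian H₁ m) z) =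
      speed m z • simpleField H₁ ((-1) ^ j * z ^ m) := by
  have hz' := abs_lt.1 hz
  rw [hamiltonianField_hamiltonian (h.hasDerivAt hz'), neg_one_pow_mul_simpleField j
    (h.deriv_neg hz'), ← mul_assoc ((m : ℂ) * z ^ (m - 1)), Complex.mul_conj, speed,
    Complex.normSq_eq_norm_sq, Complex.real_smul]
  ring

theorem IsProfile.hasDerivAt_pow_flow (h : IsProfile g H₁) (j : ℕ) {z : ℝ → ℂ} {t : ℝ}
    (hz : |(z t ^ m).re| < 1)
    (hd : HasDerivAt z (hamiltonianField (hamiltonian H₁ m) (z t)) t) :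
    HasDerivAt (fun t => (-1) ^ j * z t ^ m)
      (speed m (z t) • simpleField H₁ ((-1) ^ j * z t ^ m)) t := by
  rw [← h.mul_hamiltonianField j hz]
  exact (hd.pow m).const_mul _

/-- Differentiating (-1)^j G_j(ω)^m = ω determines the velocity of the lift up to the nonzero factor
(-1)^j m z^(m-1), which cancels. No formula for the derivative of the root is needed. -/
theorem IsProfile.hasDerivAt_rootBranch_flow (h : IsProfile g H₁) (hm : m ≠ 0) (j : ℕ)
    {ω : ℝ → ℂ} {t : ℝ} (hre : |(ω t).re| < 1) (hslit : ω t ∈ Complex.slitPlane)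
    (hd : HasDerivAt ω (speed m (rootBranch m j (ω t)) • simpleField H₁ (ω t)) t) :
    HasDerivAt (fun t => rootBranch m j (ω t))
      (hamiltonianField (hamiltonian H₁ m) (rootBranch m j (ω t))) t := by
  set z := rootBranch m j (ω t) with hz
  have hzne : z ≠ 0 := rootBranch_ne_zero hm (Complex.slitPlane_ne_zero hslit)
  have hm' : (m : ℂ) ≠ 0 := Nat.cast_ne_zero.2 hm
  have hω : (-1) ^ j * z ^ m = ω t := neg_one_pow_mul_rootBranch_pow hm j (ω t)
  have hzre : |(z ^ m).re| < 1 := by rwa [← abs_re_neg_one_pow_mul j, hω]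
  have h1 : HasDerivAt (fun t => rootBranch m j (ω t)) _ t :=
    (differentiableAt_rootBranch (m := m) (j := j) hslit).hasDerivAt.comp t hd
  have h2 : HasDerivAt (fun t => (-1) ^ j * rootBranch m j (ω t) ^ m) _ t :=
    (h1.pow m).const_mul ((-1) ^ j)
  simp only [neg_one_pow_mul_rootBranch_pow hm] at h2
  have h3 := h2.unique hd
  have h4 := h.mul_hamiltonianField j hzre
  rw [hω, ← h3] at h4
  have h5 : ((-1 : ℂ) ^ j * ((m : ℂ) * z ^ (m - 1))) ≠ 0 :=
    mul_ne_zero (pow_ne_zero _ (by norm_num)) (mul_ne_zero hm' (pow_ne_zero _ hzne))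
  refine h1.congr_deriv (mul_left_cancel₀ h5 ?_)
  rw [mul_assoc ((-1 : ℂ) ^ j), mul_assoc ((-1 : ℂ) ^ j), h4, ← hz]

/-- The simple Hamiltonian is constant along the projected orbit. -/
theorem IsProfile.simpleHamiltonian_const (h : IsProfile g H₁) {ω : ℝ → ℂ} {c : ℝ → ℝ} {r : ℝ}
    (hcont : ContinuousOn ω (Icc 0 r)) (hre : ∀ t ∈ Icc 0 r, |(ω t).re| ≤ 1)
    (hre' : ∀ t ∈ Ioo 0 r, |(ω t).re| < 1)
    (hd : ∀ t ∈ Ioo 0 r, HasDerivAt ω (c t • simpleField H₁ (ω t)) t) {t : ℝ}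
    (ht : t ∈ Icc 0 r) : simpleHamiltonian H₁ (ω t) = simpleHamiltonian H₁ (ω 0) := by
  rcases ht.1.eq_or_lt with h0 | h0
  · rw [← h0]
  have hsub : Icc 0 t ⊆ Icc 0 r := Icc_subset_Icc_right ht.2
  have h1 : ContinuousOn (fun t => simpleHamiltonian H₁ (ω t)) (Icc 0 t) := by
    unfold simpleHamiltonian
    have hc := hcont.mono hsub
    have h2 : ContinuousOn (fun t => (ω t).re) (Icc 0 t) :=
      Complex.continuous_re.comp_continuousOn hc
    have h3 : ContinuousOn (fun t => (ω t).im) (Icc 0 t) :=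
      Complex.continuous_im.comp_continuousOn hc
    exact (h.continuousOn.comp h2 fun x hx => abs_le.1 (hre x (hsub hx))).neg.add (h3.pow 2)
  have h2 : ∀ x ∈ Ioo 0 t, HasDerivAt (fun t => simpleHamiltonian H₁ (ω t)) 0 x := by
    intro x hx
    have hx' : x ∈ Ioo 0 r := ⟨hx.1, hx.2.trans_le ht.2⟩
    have h3 := (hasFDerivAt_simpleHamiltonian
      (h.hasDerivAt (abs_lt.1 (hre' x hx')))).comp_hasDerivAt x (hd x hx')
    refine h3.congr_deriv ?_
    simp [simpleField]
    ring
  obtain ⟨x, hx, hx'⟩ := exists_hasDerivAt_eq_slope _ (fun _ => 0) h0 h1 h2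
  have := (div_eq_zero_iff.1 hx'.symm).resolve_right (by linarith)
  linarith

end ImperfectSaddle

/-! ### Time changes, time integrals along orbits and the angular part of f -/

namespace ImperfectSaddle

variable {g H₁ : ℝ → ℝ} {m j : ℕ}

/-- A reparametrization of an interval with prescribed positive continuous slowness. -/
theorem exists_reparametrization {θ : ℝ → ℝ} {a b : ℝ} (hab : a < b)
    (hθ : ContinuousOn θ (Icc a b)) (hpos : ∀ p ∈ Icc a b, 0 < θ p) :
    ∃ (r : ℝ) (q : ℝ → ℝ), 0 < r ∧ q 0 = a ∧ q r = b ∧ Continuous q ∧ StrictMono q ∧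
      ∀ t ∈ Ioo 0 r, HasDerivAt q (θ (q t))⁻¹ t := by
  -- Extending the slowness by constants, with a positive lower bound δ, makes its primitive a
  -- bijection of the line, whose inverse is the reparametrization.
  set Θ : ℝ → ℝ := IccExtend hab.le ((Icc a b).domRestrict θ) with hΘ
  have hcont : Continuous Θ := (continuousOn_iff_continuous_domRestrict.1 hθ).Icc_extend'
  obtain ⟨p₀, hp₀, hmin⟩ := isCompact_Icc.exists_isMinOn (nonempty_Icc.2 hab.le) hθ
  set δ := θ p₀ with hδ
  have hδ0 : 0 < δ := hpos p₀ hp₀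
  have hge : ∀ p, δ ≤ Θ p := fun p => hmin (projIcc a b hab.le p).2
  set T : ℝ → ℝ := fun p => ∫ v in a..p, Θ v with hT
  have hTd : ∀ p, HasDerivAt T (Θ p) p := fun p =>
    intervalIntegral.integral_hasDerivAt_right (hcont.intervalIntegrable _ _)
      hcont.stronglyMeasurable.stronglyMeasurableAtFilter hcont.continuousAt
  have hTc : Continuous T := continuous_iff_continuousAt.2 fun p => (hTd p).continuousAt
  have hTmono : StrictMono T := strictMono_of_deriv_pos fun p => by
    rw [(hTd p).deriv]; exact hδ0.trans_le (hge p)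
  have hTa : T a = 0 := intervalIntegral.integral_same
  have hlin : Monotone fun p => T p - δ * (p - a) := by
    have hd : ∀ p, HasDerivAt (fun p => T p - δ * (p - a)) (Θ p - δ * 1) p := fun p =>
      (hTd p).sub (((hasDerivAt_id p).sub_const a).const_mul δ)
    refine monotone_of_deriv_nonneg (fun p => (hd p).differentiableAt) fun p => ?_
    rw [(hd p).deriv]
    linarith [hge p]
  have hsurj : Function.Surjective T := by
    have h1 : Tendsto (fun p => δ * (p - a)) atTop atTop :=
      (tendsto_atTop_add_const_right _ (-a) tendsto_id).const_mul_atTop hδ0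
    have h2 : Tendsto (fun p => δ * (p - a)) atBot atBot :=
      (tendsto_atBot_add_const_right _ (-a) tendsto_id).const_mul_atBot hδ0
    refine hTc.surjective (tendsto_atTop_mono' _ ?_ h1) (tendsto_atBot_mono' _ ?_ h2)
    · filter_upwards [eventually_ge_atTop a] with p hp
      have := hlin hp
      simp only [hTa, sub_self, mul_zero] at this
      linarith
    · filter_upwards [eventually_le_atBot a] with p hp
      have := hlin hp
      simp only [hTa, sub_self, mul_zero] at this
      linarith
  set e := hTmono.orderIsoOfSurjective T hsurj
  have heT : ∀ p, e.symm (T p) = p := fun p => e.symm_apply_apply p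
  have hTe : ∀ t, T (e.symm t) = t := fun t => e.apply_symm_apply t
  have hq0 : e.symm 0 = a := by rw [← hTa, heT]
  refine ⟨T b, e.symm, ?_, hq0, heT b, e.symm.continuous, e.symm.strictMono, ?_⟩
  · rw [← hTa]; exact hTmono hab
  · intro t ht
    have h1 : e.symm t ∈ Icc a b := by
      constructor
      · rw [← hq0]; exact e.symm.monotone ht.1.le
      · rw [← heT b]; exact e.symm.monotone ht.2.le
    have h2 := HasDerivAt.of_local_left_inverse e.symm.continuous.continuousAt
      (hTd (e.symm t)) (hδ0.trans_le (hge _)).ne' (Eventually.of_forall hTe)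
    rwa [hΘ, IccExtend_of_mem _ _ h1] at h2

/-- The orbit of the multi-saddle that runs along the image of a parametrized level curve. -/
theorem IsProfile.exists_orbit (h : IsProfile g H₁) (hm : m ≠ 0) (j : ℕ) {γ : ℝ → ℂ} {κ : ℝ → ℝ}
    {a b : ℝ} (hab : a < b) (hγ : ContinuousOn γ (Icc a b)) (hκ : ContinuousOn κ (Icc a b))
    (hpos : ∀ p ∈ Icc a b, 0 < κ p)
    (hd : ∀ p ∈ Ioo a b, HasDerivAt γ (κ p • simpleField H₁ (γ p)) p)
    (hslit : ∀ p ∈ Icc a b, γ p ∈ Complex.slitPlane) (hre : ∀ p ∈ Ioo a b, |(γ p).re| < 1) :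
    ∃ (r : ℝ) (q : ℝ → ℝ), 0 < r ∧ q 0 = a ∧ q r = b ∧ StrictMono q ∧
      ContinuousOn (fun t => rootBranch m j (γ (q t))) (Icc 0 r) ∧
      ∀ t ∈ Ioo 0 r, HasDerivAt (fun t => rootBranch m j (γ (q t)))
        (hamiltonianField (hamiltonian H₁ m) (rootBranch m j (γ (q t)))) t := by
  have hG : ContinuousOn (fun p => rootBranch m j (γ p)) (Icc a b) := fun p hp =>
    (differentiableAt_rootBranch (hslit p hp)).continuousAt.comp_continuousWithinAt (hγ p hp)
  have hspeed : ∀ p ∈ Icc a b, 0 < speed m (rootBranch m j (γ p)) := fun p hp =>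
    speed_pos hm (rootBranch_ne_zero hm (Complex.slitPlane_ne_zero (hslit p hp)))
  -- Moving along γ takes κ units of time of the simple saddle per unit of parameter. Dividing by
  -- the speed factor converts this to time of the multi-saddle.
  obtain ⟨r, q, hr, hq0, hqr, hqc, hqm, hqd⟩ := exists_reparametrization
    (θ := fun p => κ p / speed m (rootBranch m j (γ p))) hab
    (hκ.div (continuous_speed.comp_continuousOn hG) fun p hp => (hspeed p hp).ne')
    fun p hp => div_pos (hpos p hp) (hspeed p hp)
  have hmaps : MapsTo q (Icc 0 r) (Icc a b) := fun t ht => by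
    rw [← hq0, ← hqr]; exact ⟨hqm.monotone ht.1, hqm.monotone ht.2⟩
  refine ⟨r, q, hr, hq0, hqr, hqm, hG.comp hqc.continuousOn hmaps, fun t ht => ?_⟩
  have hqt : q t ∈ Ioo a b := by rw [← hq0, ← hqr]; exact ⟨hqm ht.1, hqm ht.2⟩
  have hqt' := Ioo_subset_Icc_self hqt
  refine h.hasDerivAt_rootBranch_flow hm j (ω := fun t => γ (q t)) (hre _ hqt) (hslit _ hqt') ?_
  refine ((hd _ hqt).scomp t (hqd t ht)).congr_deriv ?_
  rw [smul_smul]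
  congr 1
  have h1 := (hpos _ hqt').ne'
  have h2 := (hspeed _ hqt').ne'
  field_simp

/-- The time integral along an orbit, computed by parametrizing its trace. -/
theorem integral_orbit_eq {f : ℂ → ℂ} {z γ : ℝ → ℂ} {p Θ : ℝ → ℝ} {a b r : ℝ} (hr : 0 < r)
    (hp : ContinuousOn p (Icc 0 r)) (hp0 : p 0 = a) (hpr : p r = b)
    (hz : ∀ t ∈ Ioo 0 r, z t = γ (p t)) (hΘ : ∀ t ∈ Ioo 0 r, 0 < Θ (p t))
    (hd : ∀ t ∈ Ioo 0 r, HasDerivAt p (Θ (p t))⁻¹ t) :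
    ∫ t in (0 : ℝ)..r, f (z t) = ∫ x in a..b, Θ x • f (γ x) := by
  have hmono : StrictMonoOn p (Icc 0 r) := by
    refine strictMonoOn_of_deriv_pos (convex_Icc 0 r) hp fun t ht => ?_
    rw [interior_Icc] at ht
    rw [(hd t ht).deriv]
    exact inv_pos.2 (hΘ t ht)
  have h0 : (0 : ℝ) ∈ Icc 0 r := ⟨le_rfl, hr.le⟩
  have hr' : r ∈ Icc 0 r := ⟨hr.le, le_rfl⟩
  have himage : p '' Ioo 0 r = Ioo a b := by
    apply Subset.antisymm
    · rintro _ ⟨t, ht, rfl⟩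
      rw [← hp0, ← hpr]
      exact ⟨hmono h0 (Ioo_subset_Icc_self ht) ht.1, hmono (Ioo_subset_Icc_self ht) hr' ht.2⟩
    · rw [← hp0, ← hpr]
      exact intermediate_value_Ioo hr.le hp
  have hab : a ≤ b := by rw [← hp0, ← hpr]; exact (hmono h0 hr' hr).le
  -- The change of variables is made on the open interval, since derivatives are known only there.
  rw [intervalIntegral.integral_of_le hr.le, intervalIntegral.integral_of_le hab,
    integral_Ioc_eq_integral_Ioo, integral_Ioc_eq_integral_Ioo, ← himage,
    integral_image_eq_integral_abs_deriv_smul measurableSet_Ioo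
      (fun t ht => (hd t ht).hasDerivWithinAt) (hmono.injOn.mono Ioo_subset_Icc_self)]
  refine setIntegral_congr_fun measurableSet_Ioo fun t ht => ?_
  have := hΘ t ht
  rw [hz t ht, abs_of_pos (inv_pos.2 this), smul_smul, inv_mul_cancel₀ this.ne', one_smul]

/-- The angular part of `homPoly m a` on the image of the branch `G_j`, divided by `m²`. -/
noncomputable def angular (m j : ℕ) (a : ℕ → ℂ) (θ : ℝ) : ℂ :=
  1 / (m : ℂ) ^ 2 * ∑ k ∈ Finset.range (2 * m - 1),
    a k * Complex.exp (((2 * ((k : ℝ) - (m - 1)) * ((Real.pi * j + θ) / m) : ℝ) : ℂ) * Complex.I)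

/-- Each monomial z^k z̄^(2m-2-k) has modulus |z|^(2m-2), the power of |z| in the speed factor, so
the moduli cancel. What survives is 1/m² and the phase, of frequency k - (2m-2-k) = 2(k - (m-1)) in
arg z. -/
theorem homPoly_rootBranch (hm : m ≠ 0) (j : ℕ) (a : ℕ → ℂ) {ω : ℂ} (hω : ω ≠ 0) :
    (speed m (rootBranch m j ω))⁻¹ • homPoly m a (rootBranch m j ω) = angular m j a ω.arg := by
  have hρ0 : (0 : ℝ) < ‖ω‖ ^ (1 / m : ℝ) := Real.rpow_pos_of_pos (norm_pos_iff.2 hω) _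
  rw [rootBranch_eq m j hω]
  set ρ : ℝ := ‖ω‖ ^ (1 / m : ℝ)
  set α : ℝ := (Real.pi * j + ω.arg) / m with hα
  have hm1 : 1 ≤ m := Nat.one_le_iff_ne_zero.2 hm
  have hm' : (m : ℂ) ≠ 0 := Nat.cast_ne_zero.2 hm
  have hρ : (ρ : ℂ) ≠ 0 := Complex.ofReal_ne_zero.2 hρ0.ne'
  have hs : speed m (ρ * Complex.exp (Complex.I * α)) = (m : ℝ) ^ 2 * ρ ^ (2 * m - 2) := by
    rw [speed, norm_mul, norm_pow, norm_mul, mul_comm Complex.I, Complex.norm_exp_ofReal_mul_I,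
      Complex.norm_natCast, Complex.norm_real, Real.norm_of_nonneg hρ0.le, mul_one, mul_pow,
      ← pow_mul]
    congr 2
    omega
  rw [hs, homPoly, angular, Complex.real_smul]
  push_cast
  rw [mul_inv, one_div, mul_assoc, Finset.mul_sum]
  congr 1
  refine Finset.sum_congr rfl fun k hk => ?_
  have hk' : k ≤ 2 * m - 2 := by
    have := Finset.mem_range.1 hk
    omega
  rw [map_mul, Complex.conj_ofReal, ← Complex.exp_conj, map_mul, Complex.conj_I,
    Complex.conj_ofReal, mul_pow, mul_pow, ← Complex.exp_nat_mul, ← Complex.exp_nat_mul]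
  have h1 : (ρ : ℂ) ^ k * (ρ : ℂ) ^ (2 * m - 2 - k) = (ρ : ℂ) ^ (2 * m - 2) := by
    rw [← pow_add]; congr 1; omega
  have h2 : ((2 * m - 2 - k : ℕ) : ℂ) = 2 * m - 2 - k := by
    rw [Nat.cast_sub hk', Nat.cast_sub (by omega)]; push_cast; ring
  have h3 : Complex.exp (k * (Complex.I * α)) *
      Complex.exp (((2 * m - 2 - k : ℕ) : ℂ) * (-Complex.I * α)) =
      Complex.exp (2 * ((k : ℂ) - (m - 1)) * ((Real.pi * j + ω.arg) / m) * Complex.I) := by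
    rw [← Complex.exp_add, h2, hα]
    congr 1
    push_cast
    ring
  rw [← h3]
  field_simp
  rw [← h1]
  ring

theorem exists_isAngular_angular (m j : ℕ) (a : ℕ → ℂ) :
    ∃ (E' : ℝ → ℂ) (B : ℝ), IsAngular (angular m j a) E' B := by
  set c : ℕ → ℝ := fun k => 2 * ((k : ℝ) - (m - 1)) / m with hc
  have hbound : ∀ (d : ℂ) (e : ℕ → ℂ) (θ : ℝ), ‖d * ∑ k ∈ Finset.range (2 * m - 1),
      e k * Complex.exp (((2 * ((k : ℝ) - (m - 1)) * ((Real.pi * j + θ) / m) : ℝ) : ℂ) *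
        Complex.I)‖ ≤ ‖d‖ * ∑ k ∈ Finset.range (2 * m - 1), ‖e k‖ := by
    intro d e θ
    rw [norm_mul]
    refine mul_le_mul_of_nonneg_left (norm_sum_le_of_le _ fun k _ => ?_) (norm_nonneg _)
    rw [norm_mul, Complex.norm_exp_ofReal_mul_I, mul_one]
  refine ⟨fun θ => 1 / (m : ℂ) ^ 2 * ∑ k ∈ Finset.range (2 * m - 1), (a k * (c k * Complex.I)) *
    Complex.exp (((2 * ((k : ℝ) - (m - 1)) * ((Real.pi * j + θ) / m) : ℝ) : ℂ) * Complex.I),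
    max (‖1 / (m : ℂ) ^ 2‖ * ∑ k ∈ Finset.range (2 * m - 1), ‖a k‖)
      (‖1 / (m : ℂ) ^ 2‖ * ∑ k ∈ Finset.range (2 * m - 1), ‖a k * (c k * Complex.I)‖),
    ?_, by fun_prop, fun θ => (hbound _ _ θ).trans (le_max_left _ _),
    fun θ => (hbound _ _ θ).trans (le_max_right _ _)⟩
  intro θ
  unfold angular
  refine HasDerivAt.const_mul _ (HasDerivAt.fun_sum fun k _ => ?_)
  have h1 : HasDerivAt (fun θ : ℝ => 2 * ((k : ℝ) - (m - 1)) * ((Real.pi * j + θ) / m))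
      (c k) θ := by
    refine ((((hasDerivAt_id θ).const_add (Real.pi * j)).div_const (m : ℝ)).const_mul
      (2 * ((k : ℝ) - (m - 1)))).congr_deriv ?_
    rw [hc]; ring
  refine ((h1.ofReal_comp.mul_const Complex.I).cexp.const_mul (a k)).congr_deriv ?_
  ring

end ImperfectSaddle

/-! ### Passages seen as orbits of the simple saddle -/

namespace ImperfectSaddle

variable {g H₁ : ℝ → ℝ} {m i : ℕ} {x₀ s : ℝ}

/-- The orbit segment of a passage, seen through `z ↦ (-1)^j z^m`. -/
structure IsBaseOrbit (H₁ : ℝ → ℝ) (m j : ℕ) (x₀ : ℝ) (S : Set ℂ) (w₀ w₁ : ℂ) (r : ℝ)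
    (z ω : ℝ → ℂ) : Prop where
  start : ω 0 = w₀
  finish : ω r = w₁
  continuousOn : ContinuousOn ω (Icc 0 r)
  mem : ∀ t ∈ Icc 0 r, ω t ∈ S
  lift : ∀ t ∈ Icc 0 r, z t = rootBranch m j (ω t)
  inside : ∀ t ∈ Ioo 0 r, |(ω t).re| < x₀ ∧ |(ω t).im| < √(H₁ x₀)
  flow : ∀ t ∈ Ioo 0 r, HasDerivAt ω (speed m (z t) • simpleField H₁ (ω t)) t
  energy : ∀ t ∈ Icc 0 r, simpleHamiltonian H₁ (ω t) = simpleHamiltonian H₁ w₀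

/-- A point of the sector is G_j of some ω, and that ω must be (-1)^j z^m. Membership in the sector
thus fixes the branch at all times, without a continuity argument. -/
theorem IsPassage.exists_base (h : IsProfile g H₁) (hm : m ≠ 0) (hx₀ : x₀ ≤ 1) {j : ℕ}
    {S : Set ℂ} {w₀ w₁ : ℂ} (hS : sector H₁ m x₀ i = rootBranch m j '' S)
    (hw₀ : entrance H₁ m x₀ i s = rootBranch m j w₀)
    (hw₁ : exitPt H₁ m x₀ i s = rootBranch m j w₁) (hre : ∀ ω ∈ S, |ω.re| ≤ x₀)
    {r : ℝ} {z : ℝ → ℂ} (hz : IsPassage H₁ m x₀ i s r z) :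
    ∃ ω : ℝ → ℂ, IsBaseOrbit H₁ m j x₀ S w₀ w₁ r z ω := by
  have hlift : ∀ t ∈ Icc 0 r, (-1) ^ j * z t ^ m ∈ S ∧
      z t = rootBranch m j ((-1) ^ j * z t ^ m) := by
    intro t ht
    have h1 := hz.mem_sector t ht
    rw [hS] at h1
    obtain ⟨w, hw, hwz⟩ := h1
    rw [← hwz, neg_one_pow_mul_rootBranch_pow hm]
    exact ⟨hw, rfl⟩
  have hcont : ContinuousOn (fun t => (-1) ^ j * z t ^ m) (Icc 0 r) :=
    continuousOn_const.mul (hz.continuousOn.pow m)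
  have hin : ∀ t ∈ Ioo 0 r, |((-1) ^ j * z t ^ m).re| < x₀ ∧
      |((-1) ^ j * z t ^ m).im| < √(H₁ x₀) := fun t ht => by
    rw [abs_re_neg_one_pow_mul, abs_im_neg_one_pow_mul]
    exact hz.inside t ht
  have hflow : ∀ t ∈ Ioo 0 r, HasDerivAt (fun t => (-1) ^ j * z t ^ m)
      (speed m (z t) • simpleField H₁ ((-1) ^ j * z t ^ m)) t := fun t ht =>
    h.hasDerivAt_pow_flow j ((hz.inside t ht).1.trans_le hx₀) (hz.flow t ht)
  have hstart : (-1) ^ j * z 0 ^ m = w₀ := by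
    rw [hz.start, hw₀, neg_one_pow_mul_rootBranch_pow hm]
  refine ⟨fun t => (-1) ^ j * z t ^ m, hstart, ?_, hcont, fun t ht => (hlift t ht).1,
    fun t ht => (hlift t ht).2, hin, hflow, fun t ht => ?_⟩
  · show (-1) ^ j * z r ^ m = w₁
    rw [hz.finish, hw₁, neg_one_pow_mul_rootBranch_pow hm]
  · rw [← hstart]
    exact h.simpleHamiltonian_const hcont (fun t ht => (hre _ (hlift t ht).1).trans hx₀)
      (fun t ht => (hin t ht).1.trans_le hx₀) hflow ht

/-- The real coordinate π, the height or the abscissa, increases along the orbit at rate 1/κ in the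
time of the simple saddle. It serves as integration variable, and the speed factor in the time
change is what turns f into its angular part. -/
theorem IsBaseOrbit.integral_homPoly {j : ℕ} {S : Set ℂ} {w₀ w₁ : ℂ} {r : ℝ} {z ω : ℝ → ℂ}
    (ho : IsBaseOrbit H₁ m j x₀ S w₀ w₁ r z ω) (hm : m ≠ 0) (hr : 0 < r) (a : ℕ → ℂ)
    (π : ℂ →L[ℝ] ℝ) {γ : ℝ → ℂ} {κ : ℝ → ℝ}
    (hγ : ∀ t ∈ Ioo 0 r, ω t = γ (π (ω t))) (hslit : ∀ w ∈ S, w ≠ 0)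
    (hκ : ∀ t ∈ Ioo 0 r, 0 < κ (π (ω t)))
    (hπ : ∀ t ∈ Ioo 0 r, κ (π (ω t)) * π (simpleField H₁ (ω t)) = 1)
    (hγ0 : ∀ p ∈ uIcc (π w₀) (π w₁), γ p ≠ 0) :
    ∫ t in (0 : ℝ)..r, homPoly m a (z t) =
      ∫ p in (π w₀)..(π w₁), κ p • angular m j a (γ p).arg := by
  have hz : ∀ t ∈ Ioo 0 r, z t = rootBranch m j (γ (π (ω t))) := fun t ht => by
    rw [← hγ t ht]; exact ho.lift t (Ioo_subset_Icc_self ht)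
  have hs : ∀ t ∈ Ioo 0 r, 0 < speed m (rootBranch m j (γ (π (ω t)))) := fun t ht => by
    rw [← hγ t ht]
    exact speed_pos hm (rootBranch_ne_zero hm (hslit _ (ho.mem t (Ioo_subset_Icc_self ht))))
  rw [integral_orbit_eq (γ := fun p => rootBranch m j (γ p))
    (Θ := fun p => κ p / speed m (rootBranch m j (γ p))) (p := fun t => π (ω t)) hr
    (π.continuous.comp_continuousOn ho.continuousOn) (by rw [ho.start]) (by rw [ho.finish]) hz
    (fun t ht => div_pos (hκ t ht) (hs t ht))]
  · refine intervalIntegral.integral_congr fun p hp => ?_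
    rw [div_eq_mul_inv, ← smul_smul, homPoly_rootBranch hm j a (hγ0 p hp)]
  · intro t ht
    refine (π.hasFDerivAt.comp_hasDerivAt t (ho.flow t ht)).congr_deriv ?_
    rw [hz t ht, map_smul, smul_eq_mul, inv_div, eq_div_iff (hκ t ht).ne', mul_assoc,
      mul_comm (π _), hπ t ht, mul_one]

theorem IsProfile.exists_isPassage (h : IsProfile g H₁) (hm : m ≠ 0) (hx₀ : x₀ ≤ 1) {j : ℕ}
    {S : Set ℂ} {w₀ w₁ : ℂ} (hS : sector H₁ m x₀ i = rootBranch m j '' S)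
    (hw₀ : entrance H₁ m x₀ i s = rootBranch m j w₀)
    (hw₁ : exitPt H₁ m x₀ i s = rootBranch m j w₁) {γ : ℝ → ℂ} {κ : ℝ → ℝ} {a b : ℝ}
    (hab : a < b) (hγ : ContinuousOn γ (Icc a b)) (hκ : ContinuousOn κ (Icc a b))
    (hpos : ∀ p ∈ Icc a b, 0 < κ p)
    (hd : ∀ p ∈ Ioo a b, HasDerivAt γ (κ p • simpleField H₁ (γ p)) p)
    (hmem : ∀ p ∈ Icc a b, γ p ∈ S) (hslit : ∀ w ∈ S, w ∈ Complex.slitPlane)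
    (hin : ∀ p ∈ Ioo a b, |(γ p).re| < x₀ ∧ |(γ p).im| < √(H₁ x₀))
    (ha : γ a = w₀) (hb : γ b = w₁) :
    ∃ (r : ℝ) (z : ℝ → ℂ), IsPassage H₁ m x₀ i s r z := by
  obtain ⟨r, q, hr, hq0, hqr, hqm, hc, hflow⟩ := h.exists_orbit hm j hab hγ hκ hpos hd
    (fun p hp => hslit _ (hmem p hp)) fun p hp => (hin p hp).1.trans_le hx₀
  refine ⟨r, fun t => rootBranch m j (γ (q t)), hr, ?_, ?_, hc, fun t ht => ?_, fun t ht => ?_,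
    hflow⟩
  · simp only [hq0, ha, hw₀]
  · simp only [hqr, hb, hw₁]
  · rw [hS]
    refine mem_image_of_mem _ (hmem _ ?_)
    rw [← hq0, ← hqr]; exact ⟨hqm.monotone ht.1, hqm.monotone ht.2⟩
  · rw [rootBranch_pow hm, abs_re_neg_one_pow_mul, abs_im_neg_one_pow_mul]
    refine hin _ ?_
    rw [← hq0, ← hqr]; exact ⟨hqm ht.1, hqm ht.2⟩

theorem IsProfile.pos_of_mem (h : IsProfile g H₁) {x : ℝ} (hx : x ∈ Ioc (0 : ℝ) 1) :
    0 < H₁ x := by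
  rw [← h.zero]
  exact h.strictMonoOn ⟨le_rfl, zero_le_one⟩ ⟨hx.1.le, hx.2⟩ hx.1

theorem IsProfile.apply_abs (h : IsProfile g H₁) {x : ℝ} (hx : x ∈ Icc (-1 : ℝ) 1) :
    H₁ |x| = H₁ x := by
  rcases abs_choice x with hc | hc <;> rw [hc]
  exact h.even x hx

theorem IsProfile.abs_le_iff (h : IsProfile g H₁) {x y : ℝ} (hx : x ∈ Icc (-1 : ℝ) 1)
    (hy : y ∈ Icc (0 : ℝ) 1) : |x| ≤ y ↔ H₁ x ≤ H₁ y := by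
  rw [← h.apply_abs hx]
  exact (h.strictMonoOn.le_iff_le ⟨abs_nonneg x, abs_le.2 hx⟩ hy).symm

theorem IsProfile.abs_lt_iff (h : IsProfile g H₁) {x y : ℝ} (hx : x ∈ Icc (-1 : ℝ) 1)
    (hy : y ∈ Icc (0 : ℝ) 1) : |x| < y ↔ H₁ x < H₁ y := by
  rw [← h.apply_abs hx]
  exact (h.strictMonoOn.lt_iff_lt ⟨abs_nonneg x, abs_le.2 hx⟩ hy).symm

theorem IsProfile.nonneg (h : IsProfile g H₁) {x : ℝ} (hx : x ∈ Icc (-1 : ℝ) 1) : 0 ≤ H₁ x := by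
  rw [← h.apply_abs hx]
  exact (h.mem_range ⟨abs_nonneg x, abs_le.2 hx⟩).1

/-- The function `kernel` of the extension of `g`, as the derivative of the inverse branch. -/
theorem IsProfile.inverse_hasDerivAt_kernel (hg : IsAdmissible g) (h : IsProfile g H₁) {u : ℝ}
    (hu : u ∈ Ioo 0 (H₁ 1)) :
    HasDerivAt (inverseBranch H₁) (kernel (fun x => g (max x 0)) u) u := by
  have h1 := h.inverse_hasDerivAt hu
  rwa [← max_eq_left (a := -Real.log u) (b := 0)] at h1
  have := h.top_le hg
  linarith [Real.log_nonpos hu.1.le (by linarith [hu.2] : u ≤ 1)]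

/-- The derivative of H₁ ∘ H₁⁻¹ = id. It identifies the density of time per unit of height on the
right level curve as g(-log u)/√u. -/
theorem IsProfile.kernel_mul_deriv (hg : IsAdmissible g) (h : IsProfile g H₁) {u : ℝ}
    (hu : u ∈ Ioo 0 (H₁ 1)) :
    kernel (fun x => g (max x 0)) u * deriv H₁ (inverseBranch H₁ u) = 1 := by
  have hlt := h.inverse_strictMonoOn ⟨hu.1.le, hu.2.le⟩ ⟨hu.1.le.trans hu.2.le, le_rfl⟩ hu.2
  rw [h.inverse_apply ⟨zero_le_one, le_rfl⟩] at hlt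
  have h0 := h.inverse_pos ⟨hu.1, hu.2.le⟩
  have h1 := (h.hasDerivAt (x := inverseBranch H₁ u) ⟨by linarith, hlt⟩).comp u
    (h.inverse_hasDerivAt_kernel hg hu)
  have h2 : (H₁ ∘ inverseBranch H₁) =ᶠ[𝓝 u] id := by
    filter_upwards [Ioo_mem_nhds hu.1 hu.2] with v hv
    exact h.apply_inverse ⟨hv.1.le, hv.2.le⟩
  rw [mul_comm]
  exact h1.unique ((hasDerivAt_id u).congr_of_eventuallyEq h2)

end ImperfectSaddle

/-! ### Level curves, existence of the passages and reduction of their integrals -/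

namespace ImperfectSaddle

variable {g H₁ : ℝ → ℝ} {m i : ℕ} {x₀ s : ℝ}

theorem arg_add_mul_I_of_pos {x : ℝ} (hx : 0 < x) (y : ℝ) :
    ((x : ℂ) + y * Complex.I).arg = Real.arctan (y / x) := by
  have h1 : 0 < √(1 + (y / x) ^ 2) := Real.sqrt_pos.2 (by positivity)
  have h2 : (x : ℂ) + y * Complex.I = ((x * √(1 + (y / x) ^ 2) : ℝ) : ℂ) *
      (Complex.cos (Real.arctan (y / x) : ℝ) + Complex.sin (Real.arctan (y / x) : ℝ) *
        Complex.I) := by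
    rw [← Complex.ofReal_cos, ← Complex.ofReal_sin, Real.cos_arctan, Real.sin_arctan]
    apply Complex.ext <;> simp <;> field_simp
  rw [h2, Complex.arg_mul_cos_add_sin_mul_I (by positivity)]
  have := Real.pi_pos
  exact ⟨by linarith [Real.neg_pi_div_two_lt_arctan (y / x)],
    by linarith [Real.arctan_lt_pi_div_two (y / x)]⟩

theorem arg_neg_add_mul_I_of_pos {x y : ℝ} (hx : 0 < x) (hy : 0 < y) :
    (((-x : ℝ) : ℂ) + y * Complex.I).arg = Real.pi - Real.arctan (y / x) := by
  have h1 : 0 < √(1 + (y / x) ^ 2) := Real.sqrt_pos.2 (by positivity)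
  have h2 : ((-x : ℝ) : ℂ) + y * Complex.I = ((x * √(1 + (y / x) ^ 2) : ℝ) : ℂ) *
      (Complex.cos (Real.pi - Real.arctan (y / x) : ℝ) +
        Complex.sin (Real.pi - Real.arctan (y / x) : ℝ) * Complex.I) := by
    rw [← Complex.ofReal_cos, ← Complex.ofReal_sin, Real.cos_pi_sub, Real.sin_pi_sub,
      Real.cos_arctan, Real.sin_arctan]
    apply Complex.ext <;> simp <;> field_simp
  rw [h2, Complex.arg_mul_cos_add_sin_mul_I (by positivity)]
  have := Real.arctan_pos.2 (div_pos hy hx)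
  exact ⟨by linarith [Real.arctan_lt_pi_div_two (y / x), Real.pi_pos], by linarith⟩

theorem hasDerivAt_add_mul_I {x y : ℝ → ℝ} {x' y' p : ℝ} (hx : HasDerivAt x x' p)
    (hy : HasDerivAt y y' p) :
    HasDerivAt (fun p => (x p : ℂ) + y p * Complex.I) (⟨x', y'⟩ : ℂ) p := by
  refine (hx.ofReal_comp.add (hy.ofReal_comp.mul_const Complex.I)).congr_deriv ?_
  rw [Complex.mk_eq_add_mul_I]

/-- The level curve `H₁ x = s + y²`, `x > 0`, parametrized by `y`. -/
noncomputable def rightCurve (H₁ : ℝ → ℝ) (s y : ℝ) : ℂ :=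
  (inverseBranch H₁ (s + y ^ 2) : ℂ) + y * Complex.I

/-- The level curve `y² = s + H₁ x`, `y > 0`, parametrized by `x`. -/
noncomputable def upperCurve (H₁ : ℝ → ℝ) (s x : ℝ) : ℂ :=
  (x : ℂ) + (√(s + H₁ x) : ℝ) * Complex.I

@[simp] theorem rightCurve_re (y : ℝ) : (rightCurve H₁ s y).re = inverseBranch H₁ (s + y ^ 2) := by
  simp [rightCurve]

@[simp] theorem rightCurve_im (y : ℝ) : (rightCurve H₁ s y).im = y := by simp [rightCurve]

@[simp] theorem upperCurve_re (x : ℝ) : (upperCurve H₁ s x).re = x := by simp [upperCurve]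

@[simp] theorem upperCurve_im (x : ℝ) : (upperCurve H₁ s x).im = √(s + H₁ x) := by
  simp [upperCurve]

theorem sq_le_of_mem_Icc_sqrt {c y : ℝ} (hc : 0 ≤ c) (hy : y ∈ Icc (-√c) √c) : y ^ 2 ≤ c := by
  have := sq_le_sq' hy.1 hy.2
  rwa [Real.sq_sqrt hc] at this

theorem sq_lt_of_mem_Ioo_sqrt {c y : ℝ} (hc : 0 ≤ c) (hy : y ∈ Ioo (-√c) √c) : y ^ 2 < c := by
  have := sq_lt_sq' hy.1 hy.2
  rwa [Real.sq_sqrt hc] at this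

theorem IsProfile.exists_isPassage_right (hg : IsAdmissible g) (h : IsProfile g H₁) (hm : m ≠ 0)
    (hx₀ : x₀ ∈ Ioc (0 : ℝ) 1) (hi : Odd i) (hs : s ∈ Ioo 0 (H₁ x₀)) :
    ∃ (r : ℝ) (z : ℝ → ℂ), IsPassage H₁ m x₀ i s r z := by
  have hG := hg.slowGrowth
  have hx₀' : x₀ ∈ Icc (0 : ℝ) 1 := ⟨hx₀.1.le, hx₀.2⟩
  have hs1 := hs.1
  have hs2 : 0 < H₁ x₀ - s := sub_pos.2 hs.2
  have htop : H₁ x₀ ≤ H₁ 1 := (h.mem_range hx₀').2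
  have hY : 0 < √(H₁ x₀ - s) := Real.sqrt_pos.2 hs2
  have hu : ∀ p ∈ Icc (-√(H₁ x₀ - s)) √(H₁ x₀ - s), s + p ^ 2 ∈ Ioc 0 (H₁ x₀) := fun p hp =>
    ⟨by positivity, by linarith [sq_le_of_mem_Icc_sqrt hs2.le hp]⟩
  have hu' : ∀ p ∈ Ioo (-√(H₁ x₀ - s)) √(H₁ x₀ - s), s + p ^ 2 < H₁ x₀ := fun p hp => by
    linarith [sq_lt_of_mem_Ioo_sqrt hs2.le hp]
  have hend : inverseBranch H₁ (s + √(H₁ x₀ - s) ^ 2) = x₀ := by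
    rw [Real.sq_sqrt hs2.le, add_sub_cancel, h.inverse_apply hx₀']
  have hXle : ∀ u ∈ Ioc 0 (H₁ x₀), inverseBranch H₁ u ≤ x₀ := fun u hu => by
    rw [← h.inverse_apply hx₀']
    exact h.inverse_strictMonoOn.monotoneOn ⟨hu.1.le, hu.2.trans htop⟩ (h.mem_range hx₀') hu.2
  refine h.exists_isPassage hm hx₀.2 (j := (i - 1) / 2) (S := rightSector H₁ x₀)
    (w₀ := ⟨x₀, -√(H₁ x₀ - s)⟩) (w₁ := ⟨x₀, √(H₁ x₀ - s)⟩) (by simp [sector, hi])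
    (by simp [entrance, hi]) (by simp [exitPt, hi]) (γ := rightCurve H₁ s)
    (κ := fun y => kernel (fun x => g (max x 0)) (s + y ^ 2)) (a := -√(H₁ x₀ - s))
    (b := √(H₁ x₀ - s)) (by linarith) ?_ ?_ ?_ ?_ ?_ ?_ ?_ ?_ ?_
  · have h1 : ContinuousOn (fun y => inverseBranch H₁ (s + y ^ 2))
        (Icc (-√(H₁ x₀ - s)) √(H₁ x₀ - s)) :=
      h.inverse_continuousOn.comp (by fun_prop) fun p hp => ⟨(hu p hp).1, (hu p hp).2.trans htop⟩
    exact (Complex.continuous_ofReal.comp_continuousOn h1).add (by fun_prop)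
  · exact hG.continuousOn_kernel.comp (by fun_prop) fun p hp => (hu p hp).1
  · exact fun p hp => hG.kernel_pos (hu p hp).1
  · intro p hp
    have hp' : s + p ^ 2 ∈ Ioo 0 (H₁ 1) :=
      ⟨(hu p (Ioo_subset_Icc_self hp)).1, (hu' p hp).trans_le htop⟩
    have h1 : HasDerivAt (fun y : ℝ => s + y ^ 2) (2 * p) p := by
      simpa using (hasDerivAt_pow 2 p).const_add s
    have h2 := hasDerivAt_add_mul_I ((h.inverse_hasDerivAt_kernel hg hp').comp p h1)
      (hasDerivAt_id p)
    refine h2.congr_deriv ?_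
    have h3 := h.kernel_mul_deriv hg hp'
    apply Complex.ext
    · simp [simpleField]
    · simp [simpleField, h3]
  · intro p hp
    have h1 := hu p hp
    have h1' : s + p ^ 2 ∈ Icc 0 (H₁ 1) := ⟨h1.1.le, h1.2.trans htop⟩
    refine ⟨?_, ?_, ?_, ?_⟩
    · rw [rightCurve_re]; exact h.inverse_pos ⟨h1.1, h1'.2⟩
    · rw [rightCurve_re]; exact hXle _ h1
    · rw [rightCurve_im]; exact Real.abs_le_sqrt (by linarith [h1.2])
    · rw [rightCurve_re, rightCurve_im, h.apply_inverse h1']; linarith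
  · exact fun w hw => Complex.mem_slitPlane_iff.2 (Or.inl hw.1)
  · intro p hp
    have h1 := hu p (Ioo_subset_Icc_self hp)
    have h1' : s + p ^ 2 ∈ Ioc 0 (H₁ 1) := ⟨h1.1, h1.2.trans htop⟩
    constructor
    · rw [rightCurve_re, abs_of_pos (h.inverse_pos h1'), ← h.inverse_apply hx₀']
      exact h.inverse_strictMonoOn ⟨h1.1.le, h1'.2⟩ (h.mem_range hx₀') (hu' p hp)
    · rw [rightCurve_im, ← Real.sqrt_sq_eq_abs]
      exact Real.sqrt_lt_sqrt (sq_nonneg p) (by linarith [hu' p hp])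
  · apply Complex.ext <;> simp [hend]
  · apply Complex.ext <;> simp [hend]

/-- Conservation of energy gives H₁(x) = s + y², and x > 0 makes x a function of the height y. The
formula therefore holds for every passage, not only for a constructed one. -/
theorem IsProfile.integral_passage_right (hg : IsAdmissible g) (h : IsProfile g H₁) (hm : m ≠ 0)
    (hx₀ : x₀ ∈ Ioc (0 : ℝ) 1) (hi : Odd i) (hs : s ∈ Ioo 0 (H₁ x₀)) (a : ℕ → ℂ) {X : ℝ → ℝ}
    (hX : IsWidth (fun x => g (max x 0)) X)
    (hXeq : ∀ u ∈ Ioc 0 (H₁ x₀), X u = inverseBranch H₁ u) {r : ℝ} {z : ℝ → ℂ}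
    (hz : IsPassage H₁ m x₀ i s r z) :
    ∫ t in (0 : ℝ)..r, homPoly m a (z t) =
      ∫ v in (0 : ℝ)..√(H₁ x₀ - s), rightIntegrand (fun x => g (max x 0)) X
        (fun θ => angular m ((i - 1) / 2) a θ + angular m ((i - 1) / 2) a (-θ)) s v := by
  have hG := hg.slowGrowth
  set G : ℝ → ℝ := fun x => g (max x 0) with hGdef
  set j := (i - 1) / 2 with hj
  have hx₀' : x₀ ∈ Icc (0 : ℝ) 1 := ⟨hx₀.1.le, hx₀.2⟩
  have hs1 := hs.1
  have hs2 : 0 < H₁ x₀ - s := sub_pos.2 hs.2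
  have htop : H₁ x₀ ≤ H₁ 1 := (h.mem_range hx₀').2
  have hY : 0 < √(H₁ x₀ - s) := Real.sqrt_pos.2 hs2
  have hu : ∀ p ∈ Icc (-√(H₁ x₀ - s)) √(H₁ x₀ - s), s + p ^ 2 ∈ Ioc 0 (H₁ x₀) := fun p hp =>
    ⟨by positivity, by linarith [sq_le_of_mem_Icc_sqrt hs2.le hp]⟩
  obtain ⟨ω, ho⟩ := hz.exists_base h hm hx₀.2 (j := j) (S := rightSector H₁ x₀)
    (w₀ := ⟨x₀, -√(H₁ x₀ - s)⟩) (w₁ := ⟨x₀, √(H₁ x₀ - s)⟩) (by simp [sector, hi, hj])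
    (by simp [entrance, hi, hj]) (by simp [exitPt, hi, hj])
    (fun w hw => by rw [abs_of_pos hw.1]; exact hw.2.1)
  have hE : ∀ t ∈ Icc 0 r, H₁ (ω t).re = s + (ω t).im ^ 2 := fun t ht => by
    have h1 := ho.energy t ht
    simp only [simpleHamiltonian, neg_sq, Real.sq_sqrt hs2.le] at h1
    linarith
  have hinv : ∀ t ∈ Icc 0 r, inverseBranch H₁ (s + (ω t).im ^ 2) = (ω t).re := fun t ht => by
    rw [← hE t ht]
    exact h.inverse_apply ⟨(ho.mem t ht).1.le, (ho.mem t ht).2.1.trans hx₀.2⟩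
  have hpos : ∀ t, 0 < s + (ω t).im ^ 2 := fun t => by positivity
  have hlt : ∀ t ∈ Ioo 0 r, s + (ω t).im ^ 2 < H₁ 1 := fun t ht => by
    have ht' := Ioo_subset_Icc_self ht
    rw [← hE t ht']
    have h1 := (abs_lt.1 (ho.inside t ht).1).2
    exact h.strictMonoOn ⟨(ho.mem t ht').1.le, (h1.trans_le hx₀.2).le⟩ ⟨zero_le_one, le_rfl⟩
      (h1.trans_le hx₀.2)
  rw [ho.integral_homPoly hm hz.pos a Complex.imCLM (γ := rightCurve H₁ s)
    (κ := fun y => kernel G (s + y ^ 2))]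
  · simp only [Complex.imCLM_apply]
    have hcongr : ∀ y ∈ uIcc (-√(H₁ x₀ - s)) √(H₁ x₀ - s),
        kernel G (s + y ^ 2) • angular m j a (rightCurve H₁ s y).arg =
          rightIntegrand G X (angular m j a) s y := by
      intro y hy
      rw [uIcc_of_le (by linarith)] at hy
      have h1 := hu y hy
      rw [rightIntegrand, rightCurve, ← hXeq _ h1, arg_add_mul_I_of_pos (hX.pos hG h1.1)]
    rw [intervalIntegral.integral_congr hcongr]
    obtain ⟨E', B, hE'⟩ := exists_isAngular_angular m j a
    have hc := continuous_rightIntegrand hG hX hE' hs1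
    rw [← intervalIntegral.integral_add_adjacent_intervals (hc.intervalIntegrable _ 0)
      (hc.intervalIntegrable 0 _)]
    -- The halves y < 0 and y > 0 have the same density and opposite angles. Folding them gives E(θ)
    -- + E(-θ).
    have hneg := intervalIntegral.integral_comp_neg (a := 0) (b := √(H₁ x₀ - s))
      (fun y => rightIntegrand G X (angular m j a) s y)
    rw [neg_zero] at hneg
    have hc' : Continuous fun y => rightIntegrand G X (angular m j a) s (-y) :=
      hc.comp continuous_neg
    rw [← hneg, ← intervalIntegral.integral_add (hc'.intervalIntegrable _ _)
      (hc.intervalIntegrable _ _)]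
    refine intervalIntegral.integral_congr fun y _ => ?_
    simp only [rightIntegrand]
    rw [neg_sq, neg_div, Real.arctan_neg, smul_add, add_comm]
  · intro t ht
    have ht' := Ioo_subset_Icc_self ht
    apply Complex.ext
    · simp [hinv t ht']
    · simp
  · exact fun w hw h0 => by simpa [h0] using hw.1
  · exact fun t ht => hG.kernel_pos (hpos t)
  · intro t ht
    have h1 := h.kernel_mul_deriv hg ⟨hpos t, hlt t ht⟩
    rw [hinv t (Ioo_subset_Icc_self ht)] at h1
    exact h1
  · intro p hp h0
    simp only [Complex.imCLM_apply] at hp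
    rw [uIcc_of_le (by linarith)] at hp
    have h1 := hu p hp
    have h2 := h.inverse_pos ⟨h1.1, h1.2.trans htop⟩
    rw [← rightCurve_re (H₁ := H₁) p, h0] at h2
    simp at h2

theorem IsProfile.exists_isPassage_upper (h : IsProfile g H₁) (hm : m ≠ 0)
    (hx₀ : x₀ ∈ Ioc (0 : ℝ) 1) (hi : ¬ Odd i) (hs : s ∈ Ioo 0 (H₁ x₀)) :
    ∃ (r : ℝ) (z : ℝ → ℂ), IsPassage H₁ m x₀ i s r z := by
  have hx₀' : x₀ ∈ Icc (0 : ℝ) 1 := ⟨hx₀.1.le, hx₀.2⟩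
  have hs1 := hs.1
  have hs2 : 0 < H₁ x₀ - s := sub_pos.2 hs.2
  have htop : H₁ x₀ ≤ H₁ 1 := (h.mem_range hx₀').2
  have hmem : H₁ x₀ - s ∈ Ioc 0 (H₁ 1) := ⟨hs2, by linarith⟩
  have hmem' := Ioc_subset_Icc_self hmem
  set A := inverseBranch H₁ (H₁ x₀ - s) with hA
  have hA0 : 0 < A := h.inverse_pos hmem
  have hA1 : A < x₀ := by
    rw [← h.inverse_apply hx₀']
    exact h.inverse_strictMonoOn hmem' (h.mem_range hx₀') (by linarith)
  have hA' : A ∈ Icc (0 : ℝ) 1 := h.inverse_mem hmem'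
  have hHA : H₁ A = H₁ x₀ - s := h.apply_inverse hmem'
  have hp1 : ∀ p ∈ Icc (-A) A, p ∈ Icc (-1 : ℝ) 1 := fun p hp =>
    ⟨by linarith [hp.1, hA'.2], hp.2.trans hA'.2⟩
  have hpos : ∀ p ∈ Icc (-A) A, 0 < √(s + H₁ p) := fun p hp =>
    Real.sqrt_pos.2 (by linarith [h.nonneg (hp1 p hp)])
  have hcont : ContinuousOn (fun x => √(s + H₁ x)) (Icc (-A) A) :=
    Real.continuous_sqrt.comp_continuousOn (continuousOn_const.add (h.continuousOn.mono hp1))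
  refine h.exists_isPassage hm hx₀.2 (j := (i - 1) / 2) (S := upperSector H₁ x₀)
    (w₀ := ⟨-A, √(H₁ x₀)⟩) (w₁ := ⟨A, √(H₁ x₀)⟩) (by simp [sector, hi])
    (by simp [entrance, hi, hA]) (by simp [exitPt, hi, hA]) (γ := upperCurve H₁ s)
    (κ := fun x => 1 / (2 * √(s + H₁ x))) (a := -A)
    (b := A) (by linarith) ?_ ?_ ?_ ?_ ?_ ?_ ?_ ?_ ?_
  · exact Continuous.continuousOn (by fun_prop) |>.add
      ((Complex.continuous_ofReal.comp_continuousOn hcont).mul continuousOn_const)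
  · exact continuousOn_const.div (continuousOn_const.mul hcont) fun p hp =>
      (mul_pos two_pos (hpos p hp)).ne'
  · exact fun p hp => div_pos one_pos (mul_pos two_pos (hpos p hp))
  · intro p hp
    have hp' := Ioo_subset_Icc_self hp
    have h0 := hpos p hp'
    have h1 : HasDerivAt (fun x => s + H₁ x) (deriv H₁ p) p :=
      (h.hasDerivAt ⟨by linarith [hp.1, hA'.2], hp.2.trans_le hA'.2⟩).const_add s
    have h2 := hasDerivAt_add_mul_I (hasDerivAt_id p) (h1.sqrt (Real.sqrt_pos.1 h0).ne')
    refine h2.congr_deriv ?_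
    apply Complex.ext
    · simp [simpleField]
      field_simp
    · simp [simpleField]
      field_simp
  · intro p hp
    have h1 := (h.abs_le_iff (hp1 p hp) hA').1 (abs_le.2 hp)
    have h0 := h.nonneg (hp1 p hp)
    refine ⟨?_, ?_, ?_, ?_⟩
    · rw [upperCurve_re]; exact (abs_le.2 hp).trans hA1.le
    · rw [upperCurve_im]; exact hpos p hp
    · rw [upperCurve_im]; exact Real.sqrt_le_sqrt (by linarith)
    · rw [upperCurve_re, upperCurve_im, Real.sq_sqrt (by linarith)]; linarith
  · exact fun w hw => Complex.mem_slitPlane_iff.2 (Or.inr hw.2.1.ne')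
  · intro p hp
    have hp' := Ioo_subset_Icc_self hp
    have h1 := (h.abs_lt_iff (hp1 p hp') hA').1 (abs_lt.2 hp)
    have h0 := h.nonneg (hp1 p hp')
    constructor
    · rw [upperCurve_re]; exact (abs_lt.2 hp).trans hA1
    · rw [upperCurve_im, abs_of_nonneg (Real.sqrt_nonneg _)]
      exact Real.sqrt_lt_sqrt (by linarith) (by linarith)
  · apply Complex.ext
    · simp
    · rw [upperCurve_im, h.even A ⟨by linarith, hA'.2⟩, hHA, add_sub_cancel]
  · apply Complex.ext
    · simp
    · rw [upperCurve_im, hHA, add_sub_cancel]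

theorem IsProfile.integral_passage_upper (hg : IsAdmissible g) (h : IsProfile g H₁) (hm : m ≠ 0)
    (hx₀ : x₀ ∈ Ioc (0 : ℝ) 1) (hi : ¬ Odd i) (hs : s ∈ Ioo 0 (H₁ x₀)) (a : ℕ → ℂ) {X : ℝ → ℝ}
    (hXeq : ∀ u ∈ Ioc 0 (H₁ x₀), X u = inverseBranch H₁ u) {r : ℝ} {z : ℝ → ℂ}
    (hz : IsPassage H₁ m x₀ i s r z) :
    ∫ t in (0 : ℝ)..r, homPoly m a (z t) =
      ∫ v in (0 : ℝ)..√(H₁ x₀ - s), upperIntegrand (fun x => g (max x 0)) X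
        (fun θ => angular m ((i - 1) / 2) a θ + angular m ((i - 1) / 2) a (Real.pi - θ)) s v := by
  have hG := hg.slowGrowth
  set G : ℝ → ℝ := fun x => g (max x 0) with hGdef
  set j := (i - 1) / 2 with hj
  have hx₀' : x₀ ∈ Icc (0 : ℝ) 1 := ⟨hx₀.1.le, hx₀.2⟩
  have hs1 := hs.1
  have hs2 : 0 < H₁ x₀ - s := sub_pos.2 hs.2
  have htop : H₁ x₀ ≤ H₁ 1 := (h.mem_range hx₀').2
  have hY : 0 < √(H₁ x₀ - s) := Real.sqrt_pos.2 hs2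
  have hmem : H₁ x₀ - s ∈ Ioc 0 (H₁ 1) := ⟨hs2, by linarith⟩
  have hmem' := Ioc_subset_Icc_self hmem
  set A := inverseBranch H₁ (H₁ x₀ - s) with hA
  have hA0 : 0 < A := h.inverse_pos hmem
  have hA' : A ∈ Icc (0 : ℝ) 1 := h.inverse_mem hmem'
  have hHA : H₁ A = H₁ x₀ - s := h.apply_inverse hmem'
  have hp1 : ∀ p ∈ Icc (-A) A, p ∈ Icc (-1 : ℝ) 1 := fun p hp =>
    ⟨by linarith [hp.1, hA'.2], hp.2.trans hA'.2⟩
  have hpos : ∀ p ∈ Icc (-A) A, 0 < √(s + H₁ p) := fun p hp =>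
    Real.sqrt_pos.2 (by linarith [h.nonneg (hp1 p hp)])
  have hcont : ContinuousOn (fun x => √(s + H₁ x)) (Icc (-A) A) :=
    Real.continuous_sqrt.comp_continuousOn (continuousOn_const.add (h.continuousOn.mono hp1))
  obtain ⟨ω, ho⟩ := hz.exists_base h hm hx₀.2 (j := j) (S := upperSector H₁ x₀)
    (w₀ := ⟨-A, √(H₁ x₀)⟩) (w₁ := ⟨A, √(H₁ x₀)⟩) (by simp [sector, hi, hj])
    (by simp [entrance, hi, hj, hA]) (by simp [exitPt, hi, hj, hA])
    (fun w hw => hw.1)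
  have him : ∀ t ∈ Icc 0 r, √(s + H₁ (ω t).re) = (ω t).im := fun t ht => by
    have h1 := ho.energy t ht
    have h2 := h.even A ⟨by linarith [hA'.1], hA'.2⟩
    simp only [simpleHamiltonian, Real.sq_sqrt (hs1.trans hs.2).le, h2, hHA] at h1
    rw [show s + H₁ (ω t).re = (ω t).im ^ 2 by linarith, Real.sqrt_sq (ho.mem t ht).2.1.le]
  rw [ho.integral_homPoly hm hz.pos a Complex.reCLM (γ := upperCurve H₁ s)
    (κ := fun x => 1 / (2 * √(s + H₁ x)))]
  · simp only [Complex.reCLM_apply]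
    obtain ⟨E', B, hE'⟩ := exists_isAngular_angular m j a
    set F : ℝ → ℂ := fun x => (1 / (2 * √(s + H₁ x))) • angular m j a (upperCurve H₁ s x).arg
      with hF
    have hFc : ContinuousOn F (Icc (-A) A) := by
      have h1 : ContinuousOn (upperCurve H₁ s) (Icc (-A) A) :=
        Continuous.continuousOn (by fun_prop) |>.add
          ((Complex.continuous_ofReal.comp_continuousOn hcont).mul continuousOn_const)
      have h2 : ContinuousOn (fun x => (upperCurve H₁ s x).arg) (Icc (-A) A) := fun p hp =>
        (Complex.continuousAt_arg (Complex.mem_slitPlane_iff.2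
          (Or.inr (by rw [upperCurve_im]; exact (hpos p hp).ne')))).comp_continuousWithinAt
          (h1 p hp)
      exact (continuousOn_const.div (continuousOn_const.mul hcont) fun p hp =>
        (mul_pos two_pos (hpos p hp)).ne').smul (hE'.cont.comp_continuousOn h2)
    have hi1 : IntervalIntegrable F volume (-A) 0 := (hFc.mono (by
      rw [uIcc_of_le (by linarith)]; exact Icc_subset_Icc_right hA0.le)).intervalIntegrable
    have hi2 : IntervalIntegrable F volume 0 A := (hFc.mono (by
      rw [uIcc_of_le hA0.le]; exact Icc_subset_Icc_left (by linarith))).intervalIntegrable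
    have hi3 : IntervalIntegrable (fun x => F (-x)) volume 0 A := by
      have := (IntervalIntegrable.iff_comp_neg (f := F) (a := -A) (b := 0)).1 hi1
      rw [neg_neg, neg_zero] at this
      exact this.symm
    -- The halves x < 0 and x > 0 have equal heights because H₁ is even, and their angles are π - θ
    -- and θ.
    have hneg := intervalIntegral.integral_comp_neg (a := 0) (b := A) F
    rw [neg_zero] at hneg
    rw [← intervalIntegral.integral_add_adjacent_intervals hi1 hi2, ← hneg,
      ← intervalIntegral.integral_add hi3 hi2, intervalIntegral.integral_of_le hA0.le,
      intervalIntegral.integral_of_le hY.le, integral_Ioc_eq_integral_Ioo,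
      integral_Ioc_eq_integral_Ioo]
    -- Substitution x = H₁⁻¹(v²), that is v² = H₁(x). Its Jacobian is 2v g(-log v²)/v = 2g(-log v²),
    -- so the singularity of the inverse branch cancels and only the factor g remains.
    have hv : ∀ v ∈ Ioo 0 √(H₁ x₀ - s), v ^ 2 ∈ Ioo 0 (H₁ x₀ - s) := fun v hv =>
      ⟨pow_pos hv.1 2, sq_lt_of_mem_Ioo_sqrt hs2.le ⟨by linarith [hv.1], hv.2⟩⟩
    have himage : (fun v => inverseBranch H₁ (v ^ 2)) '' Ioo 0 √(H₁ x₀ - s) = Ioo 0 A := by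
      apply Subset.antisymm
      · rintro _ ⟨v, hv', rfl⟩
        have h1 := hv v hv'
        exact ⟨h.inverse_pos ⟨h1.1, h1.2.le.trans hmem.2⟩,
          h.inverse_strictMonoOn ⟨h1.1.le, h1.2.le.trans hmem.2⟩ hmem' h1.2⟩
      · intro x hx
        have hx' : x ∈ Icc (0 : ℝ) 1 := ⟨hx.1.le, hx.2.le.trans hA'.2⟩
        have h0 := h.pos_of_mem ⟨hx.1, hx'.2⟩
        refine ⟨√(H₁ x), ⟨Real.sqrt_pos.2 h0, Real.sqrt_lt_sqrt h0.le ?_⟩, ?_⟩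
        · rw [← hHA]; exact h.strictMonoOn hx' hA' hx.2
        · simp only
          rw [Real.sq_sqrt h0.le, h.inverse_apply hx']
    have hinj : InjOn (fun v => inverseBranch H₁ (v ^ 2)) (Ioo 0 √(H₁ x₀ - s)) := by
      intro v hv1 w hw1 hvw
      have h1 := hv v hv1
      have h2 := hv w hw1
      have h3 := h.inverse_strictMonoOn.injOn ⟨h1.1.le, h1.2.le.trans hmem.2⟩
        ⟨h2.1.le, h2.2.le.trans hmem.2⟩ hvw
      exact (pow_left_inj₀ hv1.1.le hw1.1.le two_ne_zero).1 h3
    have hder : ∀ v ∈ Ioo 0 √(H₁ x₀ - s), HasDerivWithinAt (fun v => inverseBranch H₁ (v ^ 2))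
        (kernel G (v ^ 2) * (2 * v)) (Ioo 0 √(H₁ x₀ - s)) v := by
      intro v hv'
      have h1 := hv v hv'
      have h2 : HasDerivAt (fun v : ℝ => v ^ 2) (2 * v) v := by simpa using hasDerivAt_pow 2 v
      exact (HasDerivAt.comp (h := fun v : ℝ => v ^ 2) v
        (h.inverse_hasDerivAt_kernel hg ⟨h1.1, h1.2.trans_le hmem.2⟩) h2).hasDerivWithinAt
    rw [← himage, integral_image_eq_integral_abs_deriv_smul measurableSet_Ioo hder hinj]
    refine setIntegral_congr_fun measurableSet_Ioo fun v hv' => ?_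
    have h1 := hv v hv'
    have hv0 := hv'.1
    have h2 : 0 < inverseBranch H₁ (v ^ 2) := h.inverse_pos ⟨h1.1, h1.2.le.trans hmem.2⟩
    have h3 : H₁ (inverseBranch H₁ (v ^ 2)) = v ^ 2 :=
      h.apply_inverse ⟨h1.1.le, h1.2.le.trans hmem.2⟩
    have h4 : H₁ (-inverseBranch H₁ (v ^ 2)) = v ^ 2 := by
      rw [h.even _ ?_, h3]
      have := (h.inverse_mem ⟨h1.1.le, h1.2.le.trans hmem.2⟩).2
      exact ⟨by linarith, this⟩
    have h5 : 0 < √(s + v ^ 2) := Real.sqrt_pos.2 (by positivity)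
    have h6 := hG.kernel_pos h1.1
    have h7 : kernel G (v ^ 2) * v = G (-Real.log (v ^ 2)) := by
      rw [kernel, Real.sqrt_sq hv0.le]; field_simp
    simp only [hF, upperIntegrand, upperCurve, h3, h4]
    rw [arg_add_mul_I_of_pos h2, arg_neg_add_mul_I_of_pos h2 h5, ← smul_add, smul_smul,
      abs_of_pos (by positivity), hXeq _ ⟨h1.1, by linarith [h1.2]⟩, ← h7,
      add_comm (angular m j a (Real.pi - _))]
    congr 1
    field_simp
  · intro t ht
    apply Complex.ext
    · simp
    · simp [him t (Ioo_subset_Icc_self ht)]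
  · exact fun w hw h0 => by simpa [h0] using hw.2.1
  · intro t ht
    have ht' := Ioo_subset_Icc_self ht
    have := (ho.mem t ht').2.1
    simp only [Complex.reCLM_apply]
    rw [him t ht']
    positivity
  · intro t ht
    have ht' := Ioo_subset_Icc_self ht
    have := (ho.mem t ht').2.1
    simp only [Complex.reCLM_apply, simpleField]
    rw [him t ht']
    field_simp
  · intro p hp h0
    simp only [Complex.reCLM_apply] at hp
    rw [uIcc_of_le (by linarith)] at hp
    have h2 := hpos p hp
    rw [← upperCurve_im (H₁ := H₁) (s := s) p, h0] at h2
    simp at h2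

end ImperfectSaddle

/-! ### Identification of the constants and conclusion -/

namespace ImperfectSaddle

variable {g H₁ : ℝ → ℝ} {m i : ℕ} {x₀ : ℝ}

/-- All passages give the same integral, so the choice in `passageIntegral` is harmless and
uniqueness of orbits is not needed. -/
theorem passageIntegral_eq {s : ℝ} {f : ℂ → ℂ} {c : ℂ}
    (hex : ∃ (r : ℝ) (z : ℝ → ℂ), IsPassage H₁ m x₀ i s r z)
    (heq : ∀ (r : ℝ) (z : ℝ → ℂ), IsPassage H₁ m x₀ i s r z → ∫ t in (0 : ℝ)..r, f (z t) = c) :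
    passageIntegral H₁ m x₀ i f s = c := by
  obtain ⟨r, z, hz⟩ := hex
  have h : ∃ p : ℝ × (ℝ → ℂ), IsPassage H₁ m x₀ i s p.1 p.2 := ⟨(r, z), hz⟩
  rw [passageIntegral, dif_pos h]
  exact heq _ _ h.choose_spec

theorem zeta_zpow (m : ℕ) (n : ℤ) :
    zeta m ^ n = Complex.exp (((Real.pi * n / m : ℝ) : ℂ) * Complex.I) := by
  rw [zeta, ← Complex.exp_int_mul]
  congr 1
  push_cast
  ring

theorem angular_zero (m j : ℕ) (a : ℕ → ℂ) : angular m j a 0 = rightConstant m a j := by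
  rw [angular, rightConstant]
  congr 1
  refine Finset.sum_congr rfl fun k _ => ?_
  rw [zeta_zpow]
  congr 3
  push_cast
  ring

/-- With α = π(k - (m-1))/m, the directions 0 and π have phases (2j+1)α - α and (2j+1)α + α. Their
sum is the phase (2j+1)α times 2 cos α, and cos α is the real part in the constant. -/
theorem angular_zero_add_angular_pi (m j : ℕ) (a : ℕ → ℂ) :
    angular m j a 0 + angular m j a Real.pi = 2 * upperConstant m a j := by
  rw [angular, angular, upperConstant, ← mul_add, mul_left_comm, ← Finset.sum_add_distrib]
  congr 1
  rw [Finset.mul_sum]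
  refine Finset.sum_congr rfl fun k _ => ?_
  rw [zeta_zpow, zeta_zpow, Complex.exp_ofReal_mul_I_re, Complex.ofReal_cos, ← mul_add]
  set c : ℝ := (k : ℝ) - (m - 1) with hc
  have h1 : (((2 * c * ((Real.pi * j + 0) / m) : ℝ) : ℂ) * Complex.I) =
      ((Real.pi * ((2 * (j : ℤ) + 1) * ((k : ℤ) - ((m : ℤ) - 1)) : ℤ) / m : ℝ) : ℂ) * Complex.I +
        -((Real.pi * ((k : ℤ) - ((m : ℤ) - 1) : ℤ) / m : ℝ) : ℂ) * Complex.I := by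
    rw [hc]; push_cast; ring
  have h2 : (((2 * c * ((Real.pi * j + Real.pi) / m) : ℝ) : ℂ) * Complex.I) =
      ((Real.pi * ((2 * (j : ℤ) + 1) * ((k : ℤ) - ((m : ℤ) - 1)) : ℤ) / m : ℝ) : ℂ) * Complex.I +
        ((Real.pi * ((k : ℤ) - ((m : ℤ) - 1) : ℤ) / m : ℝ) : ℂ) * Complex.I := by
    rw [hc]; push_cast; ring
  rw [h1, h2, Complex.exp_add, Complex.exp_add, Complex.cos]
  ring

/-- The folded angular function, used with c = 0 for the right sector and c = π for the upper one.
-/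
theorem IsAngular.add_comp {E E' : ℝ → ℂ} {B c : ℝ} (hE : IsAngular E E' B) :
    IsAngular (fun θ => E θ + E (c - θ)) (fun θ => E' θ - E' (c - θ)) (B + B) := by
  have h := hE.cont'
  refine ⟨fun x => ?_, by fun_prop, fun x => norm_add_le_of_le (hE.le _) (hE.le _),
    fun x => norm_sub_le_of_le (hE.le' _) (hE.le' _)⟩
  rw [sub_eq_add_neg]
  exact (hE.hasDerivAt x).add (hE.hasDerivAt (c - x)).comp_const_sub

theorem tau_extension {s : ℝ} (hs : 0 < s) (hs1 : s ≤ 1) :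
    tau (fun x => g (max x 0)) s = tau g s := by
  simp only [tau]
  rw [max_eq_left]
  linarith [Real.log_nonpos hs.le hs1]

/-- The conclusions of the theorem, from an expression of the passage integral as a
function `φ` whose derivative has the right asymptotics. -/
theorem passage_asymptotics (hg : IsAdmissible g) {s₀ : ℝ} (hs₀ : 0 < s₀) {ψ φ D : ℝ → ℂ} {C : ℂ}
    (hψ : EqOn ψ φ (Ioo 0 s₀)) (hφ : ∀ s ∈ Ioo 0 s₀, HasDerivAt φ (D s) s)
    (hlim : Tendsto (fun s => tau (fun x => g (max x 0)) s • deriv φ s) (𝓝[>] 0) (𝓝 C)) :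
    (∀ s ∈ Ioo 0 s₀, DifferentiableAt ℝ ψ s) ∧
    (deriv ψ =O[𝓝[>] 0] fun s => (tau g s)⁻¹) ∧
    Tendsto (fun s => (tau g s : ℂ) * deriv ψ s) (𝓝[>] 0) (𝓝 C) := by
  have hev : ∀ s ∈ Ioo 0 s₀, ψ =ᶠ[𝓝 s] φ := fun s hs => by
    filter_upwards [Ioo_mem_nhds hs.1 hs.2] with σ hσ using hψ hσ
  have hlim' : Tendsto (fun s => (tau g s : ℂ) * deriv ψ s) (𝓝[>] 0) (𝓝 C) := by
    refine hlim.congr' ?_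
    filter_upwards [Ioo_mem_nhdsGT hs₀, Ioo_mem_nhdsGT one_pos] with s hs hs'
    rw [tau_extension hs'.1 hs'.2.le, (hev s hs).deriv_eq, Complex.real_smul]
  refine ⟨fun s hs => ((hφ s hs).congr_of_eventuallyEq (hev s hs)).differentiableAt, ?_, hlim'⟩
  have h1 : (fun s => ((tau g s)⁻¹ : ℝ) • ((tau g s : ℂ) * deriv ψ s)) =O[𝓝[>] 0]
      fun s => (tau g s)⁻¹ • (1 : ℝ) :=
    (isBigO_refl _ _).smul (hlim'.isBigO_one ℝ)
  simp only [smul_eq_mul, mul_one] at h1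
  refine h1.congr' ?_ EventuallyEq.rfl
  filter_upwards [Ioo_mem_nhdsGT one_pos] with s hs
  have hpos : 0 < tau g s := by
    rw [← tau_extension hs.1 hs.2.le]
    exact div_pos hs.1 (hg.slowGrowth.pos _)
  rw [Complex.real_smul, ← mul_assoc, ← Complex.ofReal_mul, inv_mul_cancel₀ hpos.ne',
    Complex.ofReal_one, one_mul]

end ImperfectSaddle
open ImperfectSaddle in
theorem mainTheorem11 (g H₁ : ℝ → ℝ) (hg : IsAdmissible g) (hH₁ : IsProfile g H₁)
    (m : ℕ) (hm : 1 ≤ m) (x₀ : ℝ) (hx₀ : x₀ ∈ Set.Ioc (0 : ℝ) 1)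
    (a : ℕ → ℂ) (i : ℕ) (hi : i ∈ Finset.Icc 1 (4 * m)) :
    -- for every `0 < s < s₀ = H₁ x₀` the orbit crossing the sector exists, and the passage
    -- integral is the integral along it
    (∀ s ∈ Set.Ioo 0 (H₁ x₀),
      (∃ (r : ℝ) (z : ℝ → ℂ), IsPassage H₁ m x₀ i s r z) ∧
      ∀ (r : ℝ) (z : ℝ → ℂ), IsPassage H₁ m x₀ i s r z →
        passageIntegral H₁ m x₀ i (homPoly m a) s = ∫ t in (0 : ℝ)..r, homPoly m a (z t)) ∧
    (∀ s ∈ Set.Ioo 0 (H₁ x₀),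
      DifferentiableAt ℝ (passageIntegral H₁ m x₀ i (homPoly m a)) s) ∧
    (deriv (passageIntegral H₁ m x₀ i (homPoly m a)) =O[𝓝[>] 0] fun s => (tau g s)⁻¹) ∧
    Tendsto (fun s => (tau g s : ℂ) * deriv (passageIntegral H₁ m x₀ i (homPoly m a)) s)
      (𝓝[>] 0) (𝓝 (-sectorConstant m a i)) := by
  have hm0 : m ≠ 0 := Nat.one_le_iff_ne_zero.1 hm
  have hG := hg.slowGrowth
  have hs₀ : 0 < H₁ x₀ := hH₁.pos_of_mem hx₀
  have hs₀' : H₁ x₀ ≤ 1 / 4 :=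
    (hH₁.mem_range ⟨hx₀.1.le, hx₀.2⟩).2.trans (hH₁.top_le hg)
  obtain ⟨X, hX, hXeq⟩ := hH₁.exists_isWidth hg hx₀
  obtain ⟨E', B, hE⟩ := exists_isAngular_angular m ((i - 1) / 2) a
  by_cases hodd : Odd i
  · have hP := hE.add_comp (c := 0)
    simp only [zero_sub] at hP
    have hex := fun s hs => hH₁.exists_isPassage_right (i := i) (s := s) hg hm0 hx₀ hodd hs
    have hint := fun s hs r z hz => hH₁.integral_passage_right (s := s) (r := r) (z := z)
      hg hm0 hx₀ hodd hs a hX hXeq hz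
    have heq := fun s hs => passageIntegral_eq (hex s hs) (hint s hs)
    refine ⟨fun s hs => ⟨hex s hs, fun r z hz => (heq s hs).trans (hint s hs r z hz).symm⟩, ?_⟩
    refine passage_asymptotics hg hs₀ heq
      (fun s hs => hasDerivAt_integral_right hG hX hP hs₀' hs) ?_
    have hlim := tendsto_tau_smul_deriv_right hG hX hP hs₀ hs₀'
    -- The folded function equals 2E(0) at angle 0, which cancels the factor 1/2.
    convert hlim using 2
    rw [neg_zero, angular_zero, sectorConstant, if_pos hodd, Complex.real_smul]
    push_cast
    ring
  · have hP := hE.add_comp (c := Real.pi)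
    have hex := fun s hs => hH₁.exists_isPassage_upper (i := i) (s := s) hm0 hx₀ hodd hs
    have hint := fun s hs r z hz => hH₁.integral_passage_upper (s := s) (r := r) (z := z)
      hg hm0 hx₀ hodd hs a hXeq hz
    have heq := fun s hs => passageIntegral_eq (hex s hs) (hint s hs)
    refine ⟨fun s hs => ⟨hex s hs, fun r z hz => (heq s hs).trans (hint s hs r z hz).symm⟩, ?_⟩
    refine passage_asymptotics hg hs₀ heq
      (fun s hs => hasDerivAt_integral_upper hG hX hP hs₀' hs) ?_
    have hlim := tendsto_tau_smul_deriv_upper hG hX hP hs₀ hs₀'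
    -- The folded function equals E(0) + E(π) at angle 0, which is twice the constant.
    convert hlim using 2
    rw [sub_zero, angular_zero_add_angular_pi, sectorConstant, if_neg hodd, Complex.real_smul]
    push_cast
    ring
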